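/- Let $\mathbb F_q$ be a finite field with $q$ elements, let $\mathbb C_\infty$ be the completion of an algebraic closure of $\mathbb F_q((\theta^{-1}))$, and let $\mathbb C_\infty[T,\tau]=\mathbb C_\infty[T]\{\tau\}$ be the ring of non-commutative polynomials in which $T$ is central and $\tau a=a^q\tau$ for $a\in\mathbb C_\infty$. It acts on $\mathbb C_\infty[[T]]$ from the left: $T$ acts by multiplication, and $\tau\left(\sum_i a_iT^i\right)=\sum_i a_i^qT^i$. Let $M$ be an Anderson t-motive, i.e. a left $\mathbb C_\infty[T,\tau]$-module that is free of finite rank over $\mathbb C_\infty[T]$ and over $\mathbb C_\infty\{\tau\}$ and such that $T-\theta$ is nilpotent on $M/\tau M$. Let $f_*=(f_1,\dots,f_r)^t$ be a basis of $M$ over $\mathbb C_\infty[T]$ and $Q\in M_{r\times r}(\mathbb C_\infty[T])$ the matrix with $\tau f_*=Qf_*$; let $e_*=(e_1,\dots,e_n)^t$ be a basis of $M$ over $\mathbb C_\infty\{\tau\}$ and $A\in M_{n\times n}(\mathbb C_\infty\{\tau\})$ the matrix with $Te_*=Ae_*$. Let $E(M)=\mathrm{Hom}_{\mathbb C_\infty\{\tau\}}(M,\mathbb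 C_\infty)$, with $(Tx)(m)=x(Tm)$, be the associated t-module; the basis $e_*$ identifies it with $\mathbb C_\infty^n$, $x\mapsto(x(e_1),\dots,x(e_n))^t$, where $T$ acts through $A$. Let $$T_{\mathfrak T}(M)=\{(x_i)_{i\ge0}\mid x_i\in E(M),\ x_0=0,\ T(x_{i+1})=x_i\text{ for all }i\ge0\}.$$ Then: 1. $\varphi\mapsto(\varphi(f_1),\dots,\varphi(f_r))^t$ is a bijection from $\mathrm{Hom}_{\mathbb C_\infty[T]}(M,\mathbb C_\infty[[T]])^\tau$ (the $\mathbb C_\infty[T]$-linear maps that commute with $\tau$) onto the set of solutions $X\in\mathbb C_\infty[[T]]^r$ of the system $(I_r\tau-Q)X=0$. It restricts to a bijection from $H_1(M)=\mathrm{Hom}_{\mathbb C_\infty[T]}(M,\mathbb C_\infty\{T\})^\tau$, where $\mathbb C_\infty\{T\}$ is the set of power series whose coefficients tend to $0$, onto the set of solutions all of whose entries lie in $\mathbb C_\infty\{T\}$. 2. The system $T(x_{i+1})=x_i$, $x_0=0$, that defines $T_{\mathfrak T}(M)$ is, in the basis $e_*$ and for the generating series, the system $(I_nT-A)X=0$: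 the map $(x_i)_i\mapsto\left(\sum_{i\ge0}x_{i+1}(e_j)T^i\right)_{j=1,\dots,n}$ is a bijection from $T_{\mathfrak T}(M)$ onto the set of its solutions $X\in\mathbb C_\infty[[T]]^n$. 3. The systems $(I_r\tau-Q)X=0$ and $(I_nT-A)X=0$ coincide up to elementary transformations over $\mathbb C_\infty[T,\tau]$: one is obtained from the other by a finite sequence of the following operations and their inverses: renumbering equations or unknowns; adding to an equation a left multiple of another equation; multiplying an equation from the left by a unit; a substitution $X_j=X_j'+cX_i'$ with $i\ne j$, $c\in\mathbb C_\infty[T,\tau]$ (the other unknowns unchanged), or $X_i=uX_i'$ with $u$ a unit; introducing a new unknown $Y$ together with a new equation $Y=\sum_j p_jX_j$, $p_j\in\mathbb C_\infty[T,\tau]$ (the inverse being the elimination of $Y$). -/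

import Mathlib

noncomputable section

open scoped WithZero

/-! ### The field `ℂ_∞` -/

section CInf

variable (F : Type*) [Field F]

/-- The local field `𝔽((θ⁻¹))`: Laurent series in the variable `θ⁻¹`. -/
def KInf : Type _ := LaurentSeries F

instance : Field (KInf F) := inferInstanceAs (Field (LaurentSeries F))

/-- The valuation of `𝔽((θ⁻¹))`, normalised by `v θ = exp 1` in multiplicative notation. -/
instance : Valued (KInf F) ℤᵐ⁰ := inferInstanceAs (Valued (LaurentSeries F) ℤᵐ⁰)

instance : CompleteSpace (KInf F) := inferInstanceAs (CompleteSpace (LaurentSeries F))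

instance : Algebra F (KInf F) := inferInstanceAs (Algebra F (LaurentSeries F))

/-- The element `θ` of `𝔽((θ⁻¹))`. -/
def KInf.theta : KInf F := (HahnSeries.single (-1 : ℤ) (1 : F) : LaurentSeries F)

theorem KInf.v_theta : (Valued.v : Valuation (KInf F) ℤᵐ⁰) (KInf.theta F) = WithZero.exp (1 : ℤ) := by
  have h := LaurentSeries.valuation_single_zpow F (-1)
  rw [neg_neg] at h
  exact h

/-- The valuation has rank one; the choice of the embedding of its value group in the positive
reals fixes the base of the absolute value, and does not affect the topology. -/
instance : (Valued.v : Valuation (KInf F) ℤᵐ⁰).RankOne :=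
  { hom' := (WithZeroMulInt.toNNReal (e := 2) two_ne_zero).comp
      MonoidWithZeroHom.ValueGroup₀.embedding
    strictMono' := (WithZeroMulInt.toNNReal_strictMono one_lt_two).comp
      MonoidWithZeroHom.ValueGroup₀.embedding_strictMono
    exists_val_nontrivial := ⟨KInf.theta F, by
      rw [KInf.v_theta]
      exact ⟨WithZero.exp_ne_zero, by simp⟩⟩ }

/-- The absolute value on `𝔽((θ⁻¹))`. -/
instance : NontriviallyNormedField (KInf F) :=
  Valued.toNontriviallyNormedField (KInf F) ℤᵐ⁰

open scoped Valued in
instance : IsUltrametricDist (KInf F) :=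
  inferInstanceAs (@IsUltrametricDist (KInf F)
    (Valued.toNormedField (KInf F) ℤᵐ⁰).toMetricSpace.toPseudoMetricSpace.toDist)

/-- An algebraic closure of `𝔽((θ⁻¹))`. -/
def KInfAlgCl : Type _ := AlgebraicClosure (KInf F)

instance : Field (KInfAlgCl F) := inferInstanceAs (Field (AlgebraicClosure (KInf F)))

instance : Algebra (KInf F) (KInfAlgCl F) :=
  inferInstanceAs (Algebra (KInf F) (AlgebraicClosure (KInf F)))

instance : Algebra.IsAlgebraic (KInf F) (KInfAlgCl F) :=
  inferInstanceAs (Algebra.IsAlgebraic (KInf F) (AlgebraicClosure (KInf F)))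

/-- The unique extension of the absolute value to the algebraic closure. -/
instance : NormedField (KInfAlgCl F) := spectralNorm.normedField (KInf F) (KInfAlgCl F)

/-- `ℂ_∞`, the completion of an algebraic closure of `𝔽((θ⁻¹))`. -/
def CInf : Type _ := UniformSpace.Completion (KInfAlgCl F)

instance : NormedField (CInf F) :=
  inferInstanceAs (NormedField (UniformSpace.Completion (KInfAlgCl F)))

/-- The inclusion of `𝔽((θ⁻¹))` in `ℂ_∞`. -/
def CInf.ofKInf : KInf F →+* CInf F :=
  (UniformSpace.Completion.coeRingHom : KInfAlgCl F →+* UniformSpace.Completion (KInfAlgCl F)).comp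
    (algebraMap (KInf F) (KInfAlgCl F))

instance : Algebra F (CInf F) := ((CInf.ofKInf F).comp (algebraMap F (KInf F))).toAlgebra

/-- The element `θ` of `ℂ_∞`. -/
def CInf.theta : CInf F := CInf.ofKInf F (KInf.theta F)

/-- The powers of the Frobenius `a ↦ a ^ q` of `ℂ_∞`, where `q` is the number of elements of the
constant field: `i ∈ ℕ` acts by `a ↦ a ^ (q ^ i)`. -/
instance CInf.frobeniusAction [Fintype F] : MulSemiringAction (Multiplicative ℕ) (CInf F) where
  smul i a := a ^ (Fintype.card F ^ i.toAdd)
  one_smul a := by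
    change a ^ (Fintype.card F ^ 0) = a
    simp
  mul_smul i j a := by
    change a ^ (Fintype.card F ^ (i.toAdd + j.toAdd)) =
      (a ^ (Fintype.card F ^ j.toAdd)) ^ (Fintype.card F ^ i.toAdd)
    rw [← pow_mul, pow_add, mul_comm]
  smul_zero i := by
    change (0 : CInf F) ^ (Fintype.card F ^ i.toAdd) = 0
    exact zero_pow (pow_ne_zero _ Fintype.card_ne_zero)
  smul_add i a b := by
    change (a + b) ^ (Fintype.card F ^ i.toAdd) =
      a ^ (Fintype.card F ^ i.toAdd) + b ^ (Fintype.card F ^ i.toAdd)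
    obtain ⟨p, hp⟩ := CharP.exists F
    obtain ⟨n, hprime, hn⟩ := FiniteField.card F p
    have : Fact p.Prime := ⟨hprime⟩
    have : CharP (CInf F) p := charP_of_injective_algebraMap (algebraMap F (CInf F)).injective p
    rw [hn, ← pow_mul]
    exact add_pow_char_pow a b p _
  smul_one i := by
    change (1 : CInf F) ^ (Fintype.card F ^ i.toAdd) = 1
    simp
  smul_mul i a b := by
    change (a * b) ^ (Fintype.card F ^ i.toAdd) = _
    exact mul_pow _ _ _

theorem CInf.frobenius_smul [Fintype F] (a : CInf F) :
    Multiplicative.ofAdd 1 • a = a ^ Fintype.card F := by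
  change a ^ (Fintype.card F ^ 1) = a ^ Fintype.card F
  simp

end CInf

/-! ### The Anderson ring and its action on power series -/

section Anderson

/-- For a field `k` with an endomorphism `a ↦ a⁽¹⁾`, given by an action of `ℕ`, this is the ring
`k{τ}` of skew polynomials, `τ a = a⁽¹⁾ τ`. -/
abbrev TauRing (k : Type*) [Field k] := SkewPolynomial k

/-- The Anderson ring `k[T, τ] = k[T]{τ}`; here `ℕ` acts on `k[T]` through the coefficients, so that
`T` is central and `τ a = a⁽¹⁾ τ` for `a ∈ k`. -/
abbrev AndersonRing (k : Type*) [Field k] := SkewPolynomial (Polynomial k)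

variable (k : Type*) [Field k] [MulSemiringAction (Multiplicative ℕ) k]

namespace AndersonRing

/-- The inclusion `k[T] → k[T, τ]`. -/
def ofPoly : Polynomial k →+* AndersonRing k := SkewPolynomial.CRingHom

/-- The element `τ` of `k[T, τ]`. -/
def tau : AndersonRing k := SkewPolynomial.X

/-- The element `T` of `k[T, τ]`. -/
def T : AndersonRing k := ofPoly k Polynomial.X

/-- The inclusion `k{τ} → k[T, τ]`, `∑ aᵢ τⁱ ↦ ∑ aᵢ τⁱ`. -/
def ofTau : TauRing k →+* AndersonRing k :=
  SkewMonoidAlgebra.liftNCRingHom ((ofPoly k).comp Polynomial.C)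
    (SkewMonoidAlgebra.of (Polynomial k) (Multiplicative ℕ)) (by
      intro x y
      have hC : y • (Polynomial.C x : Polynomial k) = Polynomial.C (y • x) :=
        Polynomial.smul_C y x
      change SkewMonoidAlgebra.single 1 (Polynomial.C (y • x)) * SkewMonoidAlgebra.single y 1 =
        SkewMonoidAlgebra.single y 1 * SkewMonoidAlgebra.single 1 (Polynomial.C x)
      simp [SkewMonoidAlgebra.single_mul_single, hC])

theorem ofTau_monomial (i : ℕ) (a : k) :
    ofTau k (SkewPolynomial.monomial i a) = SkewPolynomial.monomial i (Polynomial.C a) := by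
  change SkewMonoidAlgebra.liftNC _ _ (SkewMonoidAlgebra.single _ _) = _
  rw [SkewMonoidAlgebra.liftNC_single]
  change SkewMonoidAlgebra.single 1 (Polynomial.C a) *
    SkewMonoidAlgebra.single (Multiplicative.ofAdd i) 1 = SkewMonoidAlgebra.single _ _
  simp [SkewMonoidAlgebra.single_mul_single]

theorem T_mul_ofTau (p : TauRing k) : T k * ofTau k p = ofTau k p * T k := by
  induction p using SkewPolynomial.induction with
  | h0 => simp
  | ha n r q _ _ ih =>
    rw [map_add, mul_add, add_mul, ih, ofTau_monomial]
    congr 1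
    change SkewPolynomial.C _ * _ = _ * SkewPolynomial.C _
    rw [SkewPolynomial.C_mul_monomial, SkewPolynomial.monomial_mul_C, mul_comm,
      SkewPolynomial.φ_iterate_apply, Polynomial.smul_X]

end AndersonRing

/-- The action of `ℕ` on `k⟦T⟧` through the coefficients:
`(∑ aⱼ Tʲ)⁽ⁱ⁾ = ∑ aⱼ⁽ⁱ⁾ Tʲ`. -/
def twist : Multiplicative ℕ →* AddMonoid.End (PowerSeries k) where
  toFun i := (PowerSeries.map (MulSemiringAction.toRingHom (Multiplicative ℕ) k i)).toAddMonoidHom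
  map_one' := by
    ext x n
    change PowerSeries.coeff n (PowerSeries.map
      (MulSemiringAction.toRingHom (Multiplicative ℕ) k 1) x) = PowerSeries.coeff n x
    simp
  map_mul' i j := by
    ext x n
    change PowerSeries.coeff n (PowerSeries.map
        (MulSemiringAction.toRingHom (Multiplicative ℕ) k (i * j)) x) =
      PowerSeries.coeff n (PowerSeries.map (MulSemiringAction.toRingHom (Multiplicative ℕ) k i)
        (PowerSeries.map (MulSemiringAction.toRingHom (Multiplicative ℕ) k j) x))
    simp [mul_smul]

/-- The left action of `k[T, τ]` on `k⟦T⟧`: polynomials in `T` act by multiplication, and `τ` by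
`X ↦ X⁽¹⁾`. -/
def AndersonRing.toEnd : AndersonRing k →+* AddMonoid.End (PowerSeries k) :=
  SkewMonoidAlgebra.liftNCRingHom
    ((Module.toAddMonoidEnd (PowerSeries k) (PowerSeries k)).comp
      Polynomial.coeToPowerSeries.ringHom)
    (twist k) (by
      intro x y
      ext z n
      change PowerSeries.coeff n (((y • x : Polynomial k) : PowerSeries k) *
          PowerSeries.map (MulSemiringAction.toRingHom (Multiplicative ℕ) k y) z) =
        PowerSeries.coeff n (PowerSeries.map (MulSemiringAction.toRingHom (Multiplicative ℕ) k y)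
          ((x : PowerSeries k) * z))
      have h : ((y • x : Polynomial k) : PowerSeries k) =
          PowerSeries.map (MulSemiringAction.toRingHom (Multiplicative ℕ) k y) x := by
        ext m
        simp
      rw [h, ← map_mul (PowerSeries.map _)])

instance AndersonRing.modulePowerSeries : Module (AndersonRing k) (PowerSeries k) :=
  Module.compHom (PowerSeries k) (AndersonRing.toEnd k)

theorem AndersonRing.ofPoly_smul (p : Polynomial k) (x : PowerSeries k) :
    AndersonRing.ofPoly k p • x = (p : PowerSeries k) * x := by
  have h : AndersonRing.toEnd k (SkewMonoidAlgebra.single 1 p) =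
      Module.toAddMonoidEnd (PowerSeries k) (PowerSeries k) (p : PowerSeries k) * twist k 1 :=
    SkewMonoidAlgebra.liftNC_single _ _ _ _
  rw [map_one, mul_one] at h
  exact DFunLike.congr_fun h x

theorem AndersonRing.coeff_tau_smul (x : PowerSeries k) (n : ℕ) :
    PowerSeries.coeff n (AndersonRing.tau k • x) =
      Multiplicative.ofAdd 1 • PowerSeries.coeff n x := by
  have h : AndersonRing.toEnd k (SkewMonoidAlgebra.single (Multiplicative.ofAdd 1) 1) =
      Module.toAddMonoidEnd (PowerSeries k) (PowerSeries k) ((1 : Polynomial k) : PowerSeries k) *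
        twist k (Multiplicative.ofAdd 1) :=
    SkewMonoidAlgebra.liftNC_single _ _ _ _
  rw [Polynomial.coe_one, (Module.toAddMonoidEnd (PowerSeries k) (PowerSeries k)).map_one,
    one_mul] at h
  have h' : AndersonRing.tau k • x = PowerSeries.map
      (MulSemiringAction.toRingHom (Multiplicative ℕ) k (Multiplicative.ofAdd 1)) x :=
    DFunLike.congr_fun h x
  rw [h']
  simp

/-- The left action of `k{τ}` on `k`: `(∑ aᵢ τⁱ) x = ∑ aᵢ x⁽ⁱ⁾`. -/
def TauRing.toEnd : TauRing k →+* AddMonoid.End k :=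
  SkewMonoidAlgebra.liftNCRingHom (Module.toAddMonoidEnd k k)
    (DistribMulAction.toAddMonoidEnd (Multiplicative ℕ) k) (by
      intro x y
      ext z
      change (y • x) * (y • z) = y • (x * z)
      rw [smul_mul'])

instance TauRing.moduleBase : Module (TauRing k) k :=
  Module.compHom k (TauRing.toEnd k)

theorem TauRing.monomial_smul (i : ℕ) (a x : k) :
    (SkewPolynomial.monomial i a : TauRing k) • x = a * (Multiplicative.ofAdd i • x) := by
  have h : TauRing.toEnd k (SkewMonoidAlgebra.single (Multiplicative.ofAdd i) a) =
      Module.toAddMonoidEnd k k a *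
        DistribMulAction.toAddMonoidEnd (Multiplicative ℕ) k (Multiplicative.ofAdd i) :=
    SkewMonoidAlgebra.liftNC_single _ _ _ _
  exact DFunLike.congr_fun h x

end Anderson

/-! ### Systems of affine equations -/

section Systems

variable {k : Type*} [Field k] [MulSemiringAction (Multiplicative ℕ) k]

/-- The solutions `X ∈ k⟦T⟧^κ` of the system of affine equations `P X = 0`. -/
def affineSolutions {ι κ : Type*} [Fintype κ] (P : Matrix ι κ (AndersonRing k)) :
    Set (κ → PowerSeries k) :=
  {X | ∀ i, ∑ j, P i j • X j = 0}

/-- Two systems of equations `P X = 0` and `P' X' = 0` with coefficients in a ring `R` (the columns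
of the matrices correspond to the unknowns, the rows to the equations, and the coefficients act from
the left) coincide up to elementary transformations. -/
inductive ElemEquiv {R : Type*} [Ring R] :
    ∀ {ι κ ι' κ' : Type}, Matrix ι κ R → Matrix ι' κ' R → Prop
  | refl {ι κ : Type} (P : Matrix ι κ R) : ElemEquiv P P
  | symm {ι κ ι' κ' : Type} {P : Matrix ι κ R} {P' : Matrix ι' κ' R} :
      ElemEquiv P P' → ElemEquiv P' P
  | trans {ι κ ι' κ' ι'' κ'' : Type} {P : Matrix ι κ R} {P' : Matrix ι' κ' R}
      {P'' : Matrix ι'' κ'' R} : ElemEquiv P P' → ElemEquiv P' P'' → ElemEquiv P P''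
  /-- Renumbering of the equations and of the unknowns. -/
  | reindex {ι κ ι' κ' : Type} (P : Matrix ι κ R) (s : ι ≃ ι') (t : κ ≃ κ') :
      ElemEquiv P (P.reindex s t)
  /-- Adding to the equation `i` a left multiple of another equation `j`. -/
  | addRow {ι κ : Type} (P P' : Matrix ι κ R) (i j : ι) (hij : i ≠ j) (c : R)
      (hi : ∀ b, P' i b = P i b + c * P j b) (h : ∀ a, a ≠ i → ∀ b, P' a b = P a b) :
      ElemEquiv P P'
  /-- Multiplying the equation `i` by a unit. -/
  | scaleRow {ι κ : Type} (P P' : Matrix ι κ R) (i : ι) (u : Rˣ)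
      (hi : ∀ b, P' i b = u * P i b) (h : ∀ a, a ≠ i → ∀ b, P' a b = P a b) :
      ElemEquiv P P'
  /-- The substitution `X_j = X'_j + c X'_i`, `X_b = X'_b` for `b ≠ j`, where `i ≠ j`. -/
  | addCol {ι κ : Type} (P P' : Matrix ι κ R) (i j : κ) (hij : i ≠ j) (c : R)
      (hi : ∀ a, P' a i = P a i + P a j * c) (h : ∀ b, b ≠ i → ∀ a, P' a b = P a b) :
      ElemEquiv P P'
  /-- The substitution `X_i = u X'_i` for a unit `u`. -/
  | scaleCol {ι κ : Type} (P P' : Matrix ι κ R) (i : κ) (u : Rˣ)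
      (hi : ∀ a, P' a i = P a i * u) (h : ∀ b, b ≠ i → ∀ a, P' a b = P a b) :
      ElemEquiv P P'
  /-- Introducing a new unknown `Y` together with the new equation `Y = ∑ pⱼ Xⱼ`; read backwards,
  this is the elimination of an unknown. -/
  | adjoin {ι κ : Type} (P : Matrix ι κ R) (p : κ → R) :
      ElemEquiv P (Matrix.fromBlocks P 0 (Matrix.of fun (_ : Unit) j => -p j)
        (1 : Matrix Unit Unit R))

/-- The matrix `τ I_r - Q`. -/
def tauSystem {r : ℕ} (Q : Matrix (Fin r) (Fin r) (Polynomial k)) :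
    Matrix (Fin r) (Fin r) (AndersonRing k) :=
  Matrix.diagonal (fun _ => AndersonRing.tau k) - Q.map (AndersonRing.ofPoly k)

/-- The matrix `T I_n - A`. With `X = ∑ x_{i+1} Tⁱ`, `x_i ∈ kⁿ`, and `x_0 = 0`, the system
`(T I_n - A) X = 0` is the system of equations `A x_{i+1} = x_i`, `i ≥ 0`. -/
def tateSystem {n : ℕ} (A : Matrix (Fin n) (Fin n) (TauRing k)) :
    Matrix (Fin n) (Fin n) (AndersonRing k) :=
  Matrix.diagonal (fun _ => AndersonRing.T k) - A.map (AndersonRing.ofTau k)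

/-- Small power series, i.e. the elements of `k{T}`: the coefficients tend to `0`. -/
def IsSmallSeries [TopologicalSpace k] (x : PowerSeries k) : Prop :=
  Filter.Tendsto (fun i => PowerSeries.coeff i x) Filter.atTop (nhds 0)

end Systems

/-! ### Anderson t-motives -/

section Motives

/-- The finite family `b` is a basis of the `R`-module `M`, regarded as an `S`-module through
`φ : S → R`. -/
def IsBasisOver {S R M ι : Type*} [Ring S] [Ring R] [AddCommGroup M] [Module R M] [Fintype ι]
    (φ : S →+* R) (b : ι → M) : Prop :=
  Function.Bijective fun a : ι → S => ∑ i, φ (a i) • b i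

variable {k : Type*} [Field k] [MulSemiringAction (Multiplicative ℕ) k]

/-- An Anderson t-motive: a left `k[T, τ]`-module which is free of finite rank over `k[T]`, free of
finite rank over `k{τ}`, and such that `T - θ` is nilpotent on `M / τ M`. -/
structure IsAndersonTMotive (θ : k) (M : Type*) [AddCommGroup M] [Module (AndersonRing k) M] :
    Prop where
  free_poly : ∃ (r : ℕ) (f : Fin r → M), IsBasisOver (AndersonRing.ofPoly k) f
  free_tau : ∃ (n : ℕ) (e : Fin n → M), IsBasisOver (AndersonRing.ofTau k) e
  nilpotent : ∃ m : ℕ, ∀ x : M, ∃ y : M,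
    AndersonRing.ofPoly k ((Polynomial.X - Polynomial.C θ) ^ m) • x = AndersonRing.tau k • y

variable (k) (M : Type*) [AddCommGroup M] [Module (AndersonRing k) M]

/-- `Hom_{k[T]}(M, k⟦T⟧)^τ`: the `k[T]`-linear maps that commute with `τ`. -/
def homTau : Set (M →+ PowerSeries k) :=
  {φ | (∀ (p : Polynomial k) (m : M),
      φ (AndersonRing.ofPoly k p • m) = AndersonRing.ofPoly k p • φ m) ∧
    ∀ m : M, φ (AndersonRing.tau k • m) = AndersonRing.tau k • φ m}

/-- `H_1(M) = Hom_{k[T]}(M, k{T})^τ`. -/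
def homologyOne [TopologicalSpace k] : Set (M →+ PowerSeries k) :=
  {φ | φ ∈ homTau k M ∧ ∀ m : M, IsSmallSeries (φ m)}

/-- The `k`-points of the t-module `E(M)` of `M`: `E(M) = Hom_{k{τ}}(M, k)`. A basis `e_1, …, e_n` of
`M` over `k{τ}` identifies it with `kⁿ` by `x ↦ (x(e_1), …, x(e_n))`. -/
def tModulePoints : AddSubgroup (M →+ k) where
  carrier := {x | ∀ (p : TauRing k) (m : M), x (AndersonRing.ofTau k p • m) = p • x m}
  zero_mem' := by
    intro p m
    simp
  add_mem' := by
    intro x y hx hy p m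
    simp [hx p m, hy p m]
  neg_mem' := by
    intro x hx p m
    simp [hx p m]

/-- The action of `T` on `E(M)`: `(T x)(m) = x(T m)`. -/
def tModulePoints.mulT (x : tModulePoints k M) : tModulePoints k M :=
  ⟨x.1.comp (DistribSMul.toAddMonoidHom M (AndersonRing.T k)), by
    intro p m
    change x.1 (AndersonRing.T k • AndersonRing.ofTau k p • m) = p • x.1 (AndersonRing.T k • m)
    rw [smul_smul, AndersonRing.T_mul_ofTau, ← smul_smul]
    exact x.2 p _⟩

/-- The `T`-adic Tate module of `M`: the sequences `x_0 = 0, x_1, x_2, …` in `E(M)` with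
`T x_{i+1} = x_i`. -/
def tateModule : Set (ℕ → tModulePoints k M) :=
  {x | x 0 = 0 ∧ ∀ i, tModulePoints.mulT k M (x (i + 1)) = x i}

end Motives

end

/-!
Both systems are presentations of `M`: the rows of `τ I_r - Q` are a basis of the relations between
the `f_i`, and the rows of `T I_n - A` a basis of the relations between the `e_j`. Hence the
solutions in `k⟦T⟧` of either system are the `k[T, τ]`-linear maps `M → k⟦T⟧`. Such a map is an
element of `Hom_{k[T]}(M, k⟦T⟧)^τ`, and its coefficients are a sequence of the Tate module.

After the `e_j` have been adjoined to the first presentation and the `f_i` to the second, both have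
the same generators and independent relations, so that the matrices differ by left multiplication by
an invertible matrix `U` over `k[T]{τ}`. Such a `U` acts by elementary transformations, for any Ore
extension `A[t; σ]` of a Euclidean domain with `σ` injective. Higman's linearization reduces to
matrices of degree at most one in `t`, and division by the constant term to `U = 1 + N t`.
Invertibility forces `det N = 0`, so that after a base change over `A` a row of `N` vanishes; this
row splits off, and one concludes by induction on the size.
-/

noncomputable section

open Matrix

theorem fintype_induction_sum_unit {P : ∀ (ι : Type) [Fintype ι] [DecidableEq ι], Prop}
    (of_equiv : ∀ (ι κ : Type) [Fintype ι] [DecidableEq ι] [Fintype κ] [DecidableEq κ],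
      ι ≃ κ → P ι → P κ)
    (empty : P Empty)
    (sum_unit : ∀ (ι : Type) [Fintype ι] [DecidableEq ι], P ι → P (ι ⊕ Unit))
    (ι : Type) [Fintype ι] [DecidableEq ι] : P ι := by
  suffices h : ∀ n, P (Fin n) from of_equiv _ _ (Fintype.equivFin ι).symm (h _)
  intro n
  induction n with
  | zero => exact of_equiv _ _ (Equiv.equivOfIsEmpty _ _) empty
  | succ n ih => exact of_equiv _ _ (Fintype.equivOfCardEq (by simp)) (sum_unit _ ih)

/-! ### Elementary matrices -/

section ElementaryMatrices

variable {ι κ R S : Type*} [Fintype ι] [DecidableEq ι] [Fintype κ] [DecidableEq κ]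
  [Ring R] [Ring S]

/-- The elementary matrices over a ring that need not be commutative: the products of transvections
and of diagonal matrices with at most one entry different from `1`, that entry being a unit. The
inverse of a generator is a generator, so that this submonoid consists of invertible matrices. -/
def elementaryMatrices (ι R : Type*) [Fintype ι] [DecidableEq ι] [Ring R] :
    Submonoid (Matrix ι ι R) :=
  Submonoid.closure ({g | ∃ i j c, i ≠ j ∧ g = 1 + single i j c} ∪
    {g | ∃ (i : ι) (u : Rˣ), g = diagonal (Function.update 1 i (u : R))})

namespace elementaryMatrices

theorem one_add_single_mem {i j : ι} (hij : i ≠ j) (c : R) :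
    1 + single i j c ∈ elementaryMatrices ι R :=
  Submonoid.subset_closure (Or.inl ⟨i, j, c, hij, rfl⟩)

theorem diagonal_update_mem (i : ι) (u : Rˣ) :
    diagonal (Function.update 1 i (u : R)) ∈ elementaryMatrices ι R :=
  Submonoid.subset_closure (Or.inr ⟨i, u, rfl⟩)

@[elab_as_elim]
theorem induction_on {p : ∀ g, g ∈ elementaryMatrices ι R → Prop}
    (one_add_single : ∀ i j c (hij : i ≠ j), p (1 + single i j c) (one_add_single_mem hij c))
    (diagonal_update : ∀ i (u : Rˣ),
      p (diagonal (Function.update 1 i ↑u)) (diagonal_update_mem i u))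
    (one : p 1 (one_mem _))
    (mul : ∀ g h hg hh, p g hg → p h hh → p (g * h) (mul_mem hg hh))
    {g : Matrix ι ι R} (hg : g ∈ elementaryMatrices ι R) : p g hg := by
  induction hg using Submonoid.closure_induction with
  | mem g hg =>
    rcases hg with ⟨i, j, c, hij, rfl⟩ | ⟨i, u, rfl⟩
    · exact one_add_single i j c hij
    · exact diagonal_update i u
  | one => exact one
  | mul g h hg hh ihg ihh => exact mul g h hg hh ihg ihh

theorem exists_inverse {g : Matrix ι ι R} (hg : g ∈ elementaryMatrices ι R) :
    ∃ h ∈ elementaryMatrices ι R, g * h = 1 ∧ h * g = 1 := by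
  induction hg using induction_on with
  | one_add_single i j c hij =>
    refine ⟨1 + single i j (-c), one_add_single_mem hij _, ?_, ?_⟩ <;>
      simp [add_mul, mul_add, single_mul_single_of_ne, hij.symm, ← single_add, add_assoc]
  | diagonal_update i u =>
    have cancel (u : Rˣ) : diagonal (Function.update 1 i (u : R)) *
        diagonal (Function.update 1 i (↑u⁻¹ : R)) = 1 := by
      rw [diagonal_mul_diagonal, ← diagonal_one, diagonal_eq_diagonal_iff]
      intro j
      obtain rfl | h := eq_or_ne j i <;> simp [*]
    exact ⟨_, diagonal_update_mem i u⁻¹, cancel u, by simpa using cancel u⁻¹⟩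
  | one => exact ⟨1, one_mem _, by simp⟩
  | mul g h _ _ hg hh =>
    obtain ⟨g', hg', hgg', hg'g⟩ := hg
    obtain ⟨h', hh', hhh', hh'h⟩ := hh
    refine ⟨h' * g', mul_mem hh' hg', ?_, ?_⟩
    · rw [mul_assoc, ← mul_assoc h, hhh', one_mul, hgg']
    · rw [mul_assoc, ← mul_assoc g', hg'g, one_mul, hh'h]

theorem isUnit {g : Matrix ι ι R} (hg : g ∈ elementaryMatrices ι R) : IsUnit g := by
  obtain ⟨h, -, hgh, hhg⟩ := exists_inverse hg
  exact ⟨⟨g, h, hgh, hhg⟩, rfl⟩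

theorem map_mem (φ : R →+* S) {g : Matrix ι ι R} (hg : g ∈ elementaryMatrices ι R) :
    φ.mapMatrix g ∈ elementaryMatrices ι S := by
  induction hg using induction_on with
  | one_add_single i j c hij =>
    rw [RingHom.mapMatrix_apply, Matrix.map_add _ (map_add φ),
      Matrix.map_one _ (map_zero φ) (map_one φ), map_single]
    exact one_add_single_mem hij _
  | diagonal_update i u =>
    convert diagonal_update_mem i (u.map φ.toMonoidHom) using 1
    rw [RingHom.mapMatrix_apply, diagonal_map (map_zero φ), diagonal_eq_diagonal_iff]
    intro j
    obtain rfl | h := eq_or_ne j i <;> simp [*]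
  | one => rw [map_one]; exact one_mem _
  | mul g h _ _ hg hh =>
    rw [map_mul]
    exact mul_mem hg hh

theorem reindex_mem (e : ι ≃ κ) {g : Matrix ι ι R} (hg : g ∈ elementaryMatrices ι R) :
    g.reindex e e ∈ elementaryMatrices κ R := by
  induction hg using induction_on with
  | one_add_single i j c hij =>
    convert one_add_single_mem (e.injective.ne hij) c using 1
    ext a b
    simp [one_apply, single_apply, Equiv.eq_symm_apply]
  | diagonal_update i u =>
    convert diagonal_update_mem (e i) u using 1
    rw [reindex_apply, submatrix_diagonal_equiv, diagonal_eq_diagonal_iff]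
    intro j
    obtain rfl | h := eq_or_ne j (e i) <;> simp [*, Equiv.symm_apply_eq]
  | one => simp
  | mul g h _ _ hg hh =>
    rw [← coe_reindexRingEquiv] at *
    rw [map_mul]
    exact mul_mem hg hh

theorem fromBlocks_one_mem {g : Matrix ι ι R} (hg : g ∈ elementaryMatrices ι R) :
    fromBlocks g 0 0 (1 : Matrix κ κ R) ∈ elementaryMatrices (ι ⊕ κ) R := by
  induction hg using induction_on with
  | one_add_single i j c hij =>
    convert one_add_single_mem (Sum.inl_injective.ne hij) c using 1
    ext (a | a) (b | b) <;> simp [one_apply, single_apply]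
  | diagonal_update i u =>
    convert diagonal_update_mem (Sum.inl i) u using 1
    rw [← diagonal_one, fromBlocks_diagonal, diagonal_eq_diagonal_iff]
    rintro (j | j)
    · obtain rfl | h := eq_or_ne j i <;> simp [*]
    · simp
  | one => simp
  | mul g h _ _ hg hh => simpa [fromBlocks_multiply] using mul_mem hg hh

theorem fromBlocks_one_zero_mem (C : Matrix κ ι R) :
    fromBlocks 1 0 C 1 ∈ elementaryMatrices (ι ⊕ κ) R := by
  induction C using Matrix.induction_on' with
  | h_zero => simp
  | h_add C D hC hD => simpa [fromBlocks_multiply] using mul_mem hC hD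
  | h_std_basis i j c =>
    convert one_add_single_mem (Sum.inr_ne_inl (a := j) (b := i)) c using 1
    ext (a | a) (b | b) <;> simp [one_apply, single_apply]

theorem fromBlocks_one_one_mem (D : Matrix ι κ R) :
    fromBlocks 1 D 0 1 ∈ elementaryMatrices (ι ⊕ κ) R := by
  simpa using reindex_mem (Equiv.sumComm κ ι) (fromBlocks_one_zero_mem D)

theorem fromBlocks_mem {X : Matrix ι ι R} {Y : Matrix κ κ R} (hX : X ∈ elementaryMatrices ι R)
    (hY : Y ∈ elementaryMatrices κ R) (D : Matrix ι κ R) :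
    fromBlocks X D 0 Y ∈ elementaryMatrices (ι ⊕ κ) R := by
  have hY' : fromBlocks 1 0 0 Y ∈ elementaryMatrices (ι ⊕ κ) R := by
    simpa using reindex_mem (Equiv.sumComm κ ι) (fromBlocks_one_mem hY)
  simpa [fromBlocks_multiply] using
    mul_mem hY' (mul_mem (fromBlocks_one_one_mem D) (fromBlocks_one_mem hX))

theorem vecMul_single_eq_single (v : ι → R) (i j : ι) (c : R) :
    v ᵥ* single i j c = Pi.single j (v i * c) := by
  ext b
  simp [vecMul, dotProduct, single_apply, Pi.single_apply, ite_and, eq_comm]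

theorem exists_vecMul_apply_eq (v : ι → R) {i j : ι} (hij : i ≠ j) (c : R) :
    ∃ h ∈ elementaryMatrices ι R, (v ᵥ* h) j = v i + v j * c := by
  refine ⟨_, mul_mem (one_add_single_mem hij.symm (c - 1)) (one_add_single_mem hij 1), ?_⟩
  rw [← vecMul_vecMul]
  simp [vecMul_add, vecMul_single_eq_single, hij, mul_sub]
  abel

end elementaryMatrices

section EuclideanDomain

variable {A : Type*} [EuclideanDomain A]

/- Take `h` such that the last entry of `v ᵥ* h` is nonzero and as small as possible; it divides all
the other entries, since otherwise a remainder could be moved to its place. -/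
theorem exists_vecMul_inl_eq_zero (v : ι ⊕ Unit → A) :
    ∃ h ∈ elementaryMatrices (ι ⊕ Unit) A, ∀ i, (v ᵥ* h) (Sum.inl i) = 0 := by
  by_cases hv : ∀ h ∈ elementaryMatrices (ι ⊕ Unit) A, (v ᵥ* h) (Sum.inr ()) = 0
  · refine ⟨1, one_mem _, fun i => ?_⟩
    obtain ⟨h, hh, hi⟩ := elementaryMatrices.exists_vecMul_apply_eq v
      (Sum.inl_ne_inr (a := i) (b := ())) 0
    simpa [hi] using hv h hh
  · push Not at hv
    let last : Set A := {a | a ≠ 0 ∧ ∃ h ∈ elementaryMatrices (ι ⊕ Unit) A,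
      (v ᵥ* h) (Sum.inr ()) = a}
    have last_nonempty : last.Nonempty := by
      obtain ⟨h, hh, h0⟩ := hv
      exact ⟨_, h0, h, hh, rfl⟩
    obtain ⟨a, ⟨ha, h, hh, rfl⟩, hmin⟩ := EuclideanDomain.r_wellFounded.has_min last last_nonempty
    set w := v ᵥ* h with hw
    have hdvd (i : ι) : w (Sum.inl i) % w (Sum.inr ()) = 0 := by
      by_contra hmod
      obtain ⟨h', hh', hlast⟩ := elementaryMatrices.exists_vecMul_apply_eq w
        (Sum.inl_ne_inr (a := i) (b := ())) (-(w (Sum.inl i) / w (Sum.inr ())))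
      rw [mul_neg, ← sub_eq_add_neg, ← EuclideanDomain.mod_eq_sub_mul_div] at hlast
      exact hmin _ ⟨hmod, h * h', mul_mem hh hh', by rw [← vecMul_vecMul, hlast]⟩
        (EuclideanDomain.mod_lt _ ha)
    refine ⟨_, mul_mem hh (elementaryMatrices.fromBlocks_one_zero_mem
      (of fun _ i => -(w (Sum.inl i) / w (Sum.inr ())))), fun i => ?_⟩
    rw [← vecMul_vecMul, ← hw, vecMul_fromBlocks]
    have := EuclideanDomain.mod_eq_sub_mul_div (w (Sum.inl i)) (w (Sum.inr ()))
    simpa [hdvd, vecMul, dotProduct, sub_eq_add_neg, eq_comm] using this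

theorem mem_elementaryMatrices_of_isUnit {ι : Type} [Fintype ι] [DecidableEq ι] {g : Matrix ι ι A}
    (hg : IsUnit g) : g ∈ elementaryMatrices ι A := by
  revert g
  refine fintype_induction_sum_unit
    (P := fun ι _ _ => ∀ {g : Matrix ι ι A}, IsUnit g → g ∈ elementaryMatrices ι A) ?_ ?_ ?_ ι
  · intro ι κ _ _ _ _ e ih g hg
    have hg' : IsUnit (g.reindex e.symm e.symm) := hg.map (reindexRingEquiv A e.symm)
    simpa using elementaryMatrices.reindex_mem e (ih hg')
  · intro g _
    rw [Subsingleton.elim g 1]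
    exact one_mem _
  · intro ι _ _ ih g hg
    obtain ⟨h, hh, h0⟩ := exists_vecMul_inl_eq_zero (g (Sum.inr ()))
    obtain ⟨h', hh', hhh', -⟩ := elementaryMatrices.exists_inverse hh
    have hgh : g * h = fromBlocks (g * h).toBlocks₁₁ (g * h).toBlocks₁₂ 0 (g * h).toBlocks₂₂ := by
      conv_lhs => rw [← fromBlocks_toBlocks (g * h)]
      congr 1
      ext _ b
      exact h0 b
    have hunit : IsUnit (g * h) := hg.mul (IsUnit.of_mul_eq_one _ hhh')
    rw [hgh, isUnit_fromBlocks_zero₂₁] at hunit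
    obtain ⟨u, hu⟩ := (isUnit_iff_isUnit_det _).1 hunit.2
    have hlast : (g * h).toBlocks₂₂ ∈ elementaryMatrices Unit A := by
      convert elementaryMatrices.diagonal_update_mem () u using 1
      ext
      simp [hu]
    have hmem := elementaryMatrices.fromBlocks_mem (ih hunit.1) hlast (g * h).toBlocks₁₂
    rw [← hgh] at hmem
    simpa [mul_assoc, hhh'] using mul_mem hmem hh'

end EuclideanDomain

end ElementaryMatrices

/-! ### Elementary transformations of systems -/

namespace ElemEquiv

variable {R : Type*} [Ring R] {ι κ μ : Type}

theorem adjoin_matrix [Finite μ] [DecidableEq μ] (P : Matrix ι κ R) (S : Matrix μ κ R) :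
    ElemEquiv P (fromBlocks P 0 (-S) (1 : Matrix μ μ R)) := by
  cases nonempty_fintype μ
  revert S
  refine fintype_induction_sum_unit (P := fun μ _ _ => ∀ S : Matrix μ κ R,
    ElemEquiv P (fromBlocks P 0 (-S) (1 : Matrix μ μ R))) ?_ ?_ ?_ μ
  · intro μ ν _ _ _ _ e ih S
    convert (ih (S.submatrix e id)).trans
      (reindex _ (Equiv.sumCongr (Equiv.refl ι) e) (Equiv.sumCongr (Equiv.refl κ) e)) using 1
    ext (i | i) (j | j) <;> simp [one_apply]
  · intro S
    convert reindex P (Equiv.sumEmpty ι Empty).symm (Equiv.sumEmpty κ Empty).symm using 1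
    ext (i | i) (j | j) <;> first | exact i.elim | exact j.elim | simp
  · intro μ _ _ ih S
    convert ((ih (S.submatrix Sum.inl id)).trans (adjoin _ (Sum.elim (S (Sum.inr ())) 0))).trans
      (reindex _ (Equiv.sumAssoc ι μ Unit) (Equiv.sumAssoc κ μ Unit)) using 1
    ext (i | i | i) (j | j | j) <;> simp [one_apply]

/-- The square matrices `U` over `R` such that every system `P X = 0` coincides with `U P X = 0` up
to elementary transformations. -/
def leftStabilizer (ι : Type) (R : Type*) [Fintype ι] [DecidableEq ι] [Ring R] :
    Submonoid (Matrix ι ι R) where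
  carrier := {U | ∀ (κ : Type) (P : Matrix ι κ R), ElemEquiv P (U * P)}
  one_mem' _ P := by simpa using refl P
  mul_mem' {U V} hU hV _ P := by simpa [Matrix.mul_assoc] using (hV _ P).trans (hU _ (V * P))

section leftStabilizer

variable [Fintype ι] [DecidableEq ι] [Fintype κ] [DecidableEq κ]

theorem elementaryMatrices_le_leftStabilizer : elementaryMatrices ι R ≤ leftStabilizer ι R := by
  intro g hg
  induction hg using elementaryMatrices.induction_on with
  | one_add_single i j c hij =>
    exact fun _ P => addRow P _ i j hij c (fun b => by simp [Matrix.add_mul])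
      fun a ha b => by simp [Matrix.add_mul, ha]
  | diagonal_update i u =>
    exact fun _ P => scaleRow P _ i u (fun b => by simp) fun a ha b => by simp [ha]
  | one => exact one_mem _
  | mul g h _ _ hg hh => exact mul_mem hg hh

theorem mem_leftStabilizer_of_fromBlocks_one_mem {U : Matrix ι ι R}
    (hU : fromBlocks U 0 0 (1 : Matrix κ κ R) ∈ leftStabilizer (ι ⊕ κ) R) :
    U ∈ leftStabilizer ι R := fun μ P => by
  have stabilize (P : Matrix ι μ R) : ElemEquiv P (fromBlocks P 0 0 (1 : Matrix κ κ R)) := by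
    simpa using adjoin_matrix P (0 : Matrix κ μ R)
  have h := hU _ (fromBlocks P 0 0 (1 : Matrix κ κ R))
  rw [fromBlocks_multiply] at h
  simp only [Matrix.mul_zero, Matrix.zero_mul, add_zero, zero_add, Matrix.one_mul] at h
  exact ((stabilize P).trans h).trans (stabilize (U * P)).symm

end leftStabilizer

end ElemEquiv

/-! ### Ore extensions -/

/-- `R` is the Ore extension `S[t; σ]`: the free left `S`-module on the powers of `t`, with the
commutation rule `t s = σ(s) t`. The embedding `φ` of `S` is part of the data, so that one ring can
be regarded as an Ore extension in several ways. -/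
structure IsOreExtension {S R : Type*} [Ring S] [Ring R] (φ : S →+* R) (σ : S →+* S) (t : R) :
    Prop where
  mul_map : ∀ s, t * φ s = φ (σ s) * t
  bijective : Function.Bijective fun c : ℕ →₀ S => c.sum fun i s => φ s * t ^ i

namespace IsOreExtension

section Ring

variable {S R : Type*} [Ring S] [Ring R] {φ : S →+* R} {σ : S →+* S} {t : R}

theorem of_coeff (mul_map : ∀ s, t * φ s = φ (σ s) * t) (coeff : R →+ ℕ → S)
    (coeff_map_mul_pow : ∀ s i, coeff (φ s * t ^ i) = Pi.single i s)
    (closure : AddSubmonoid.closure {p | ∃ s i, p = φ s * t ^ i} = ⊤) : IsOreExtension φ σ t where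
  mul_map := mul_map
  bijective := by
    let ofFinsupp : (ℕ →₀ S) →+ R :=
      Finsupp.liftAddHom fun i => (AddMonoidHom.mulRight (t ^ i)).comp φ.toAddMonoidHom
    have coeff_ofFinsupp : coeff.comp ofFinsupp = Finsupp.coeFnAddHom :=
      Finsupp.addHom_ext' fun i => AddMonoidHom.ext fun s => by
        change coeff (ofFinsupp (Finsupp.single i s)) = ⇑(Finsupp.single i s)
        simp [ofFinsupp, coeff_map_mul_pow, Finsupp.single_eq_pi_single]
    refine ⟨fun c d hcd => DFunLike.coe_injective ?_, fun p => ?_⟩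
    · exact (DFunLike.congr_fun coeff_ofFinsupp c).symm.trans
        ((congrArg coeff hcd).trans (DFunLike.congr_fun coeff_ofFinsupp d))
    · have hp : p ∈ AddSubmonoid.closure {p | ∃ s i, p = φ s * t ^ i} := closure ▸ trivial
      refine (AddSubmonoid.closure_le (S := AddMonoidHom.mrange ofFinsupp)).2 ?_ hp
      rintro _ ⟨s, i, rfl⟩
      exact ⟨Finsupp.single i s, by simp [ofFinsupp]⟩

variable (h : IsOreExtension φ σ t)

/-- The coefficients of the elements of an Ore extension. -/
def coeff : R ≃+ (ℕ →₀ S) :=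
  (AddEquiv.ofBijective
    (Finsupp.liftAddHom fun i => (AddMonoidHom.mulRight (t ^ i)).comp φ.toAddMonoidHom)
    h.bijective).symm

theorem coeff_map_mul_pow (s : S) (i : ℕ) : h.coeff (φ s * t ^ i) = Finsupp.single i s :=
  (AddEquiv.symm_apply_eq _).2 (by simp)

include h in
theorem induction_add {p : R → Prop} (map_mul_pow : ∀ s i, p (φ s * t ^ i))
    (add : ∀ x y, p x → p y → p (x + y)) (x : R) : p x := by
  obtain ⟨c, rfl⟩ := h.coeff.symm.surjective x
  induction c using Finsupp.induction_linear with
  | zero => simpa using map_mul_pow 0 0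
  | add c d hc hd => rw [map_add]; exact add _ _ hc hd
  | single i s => rw [← h.coeff_map_mul_pow, AddEquiv.symm_apply_apply]; exact map_mul_pow s i

theorem coeff_map (s : S) : h.coeff (φ s) = Finsupp.single 0 s := by
  simpa using h.coeff_map_mul_pow s 0

theorem coeff_one : h.coeff 1 = Finsupp.single 0 1 := by
  simpa using h.coeff_map 1

theorem coeff_self : h.coeff t = Finsupp.single 1 1 := by
  simpa using h.coeff_map_mul_pow 1 1

theorem coeff_mul_self_zero (p : R) : h.coeff (p * t) 0 = 0 := by
  induction p using h.induction_add with
  | map_mul_pow s i => simp [mul_assoc, ← pow_succ, h.coeff_map_mul_pow]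
  | add x y hx hy => simp [add_mul, hx, hy]

theorem coeff_mul_self_succ (p : R) (i : ℕ) : h.coeff (p * t) (i + 1) = h.coeff p i := by
  induction p using h.induction_add with
  | map_mul_pow s j => simp [mul_assoc, ← pow_succ, h.coeff_map_mul_pow, Finsupp.single_apply]
  | add x y hx hy => simp [add_mul, hx, hy]

include h in
theorem pow_mul_map (i : ℕ) (s : S) : t ^ i * φ s = φ (σ^[i] s) * t ^ i := by
  induction i with
  | zero => simp
  | succ i ih =>
    rw [pow_succ', mul_assoc, ih, ← mul_assoc, h.mul_map, mul_assoc, Function.iterate_succ_apply']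

theorem coeff_mul_map (p : R) (s : S) (i : ℕ) : h.coeff (p * φ s) i = h.coeff p i * σ^[i] s := by
  induction p using h.induction_add with
  | map_mul_pow u j =>
    rw [mul_assoc, h.pow_mul_map, ← mul_assoc, ← map_mul, h.coeff_map_mul_pow, h.coeff_map_mul_pow]
    obtain rfl | hij := eq_or_ne j i <;> simp [*]
  | add x y hx hy => simp [add_mul, hx, hy]

theorem eventually_coeff_eq_zero (p : R) : ∀ᶠ i in Filter.atTop, h.coeff p i = 0 := by
  rw [← Nat.cofinite_eq_atTop]
  exact (h.coeff p).hasFiniteSupport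

theorem exists_eq_map_add_mul (p : R) : ∃ q, p = φ (h.coeff p 0) + q * t := by
  induction p using h.induction_add with
  | map_mul_pow s i =>
    cases i with
    | zero => exact ⟨0, by simp [h.coeff_map]⟩
    | succ i => exact ⟨φ s * t ^ i, by
        simp [pow_succ, ← mul_assoc, h.coeff_mul_self_zero]⟩
  | add x y hx hy =>
    obtain ⟨q, hq⟩ := hx
    obtain ⟨r, hr⟩ := hy
    refine ⟨q + r, ?_⟩
    conv_lhs => rw [hq, hr]
    simp [add_mul, add_add_add_comm]

/-- The constant coefficient, as a ring homomorphism. -/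
def constantCoeff : R →+* S where
  toFun p := h.coeff p 0
  map_one' := by simp [h.coeff_one]
  map_zero' := by simp
  map_add' := by simp
  map_mul' p q := by
    obtain ⟨r, hr⟩ := h.exists_eq_map_add_mul q
    conv_lhs => rw [hr]
    simp [mul_add, ← mul_assoc, h.coeff_mul_self_zero, h.coeff_mul_map]

include h in
theorem exists_eq_mul_sub_add (a : S) (p : R) : ∃ q c, p = q * (t - φ a) + φ c := by
  have hpow (i : ℕ) : ∃ q c, t ^ i = q * (t - φ a) + φ c := by
    induction i with
    | zero => exact ⟨0, 1, by simp⟩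
    | succ i ih =>
      obtain ⟨q, c, hqc⟩ := ih
      refine ⟨t * q + φ (σ c), σ c * a, ?_⟩
      rw [pow_succ', hqc, mul_add, h.mul_map, map_mul]
      noncomm_ring
  induction p using h.induction_add with
  | map_mul_pow s i =>
    obtain ⟨q, c, hqc⟩ := hpow i
    exact ⟨φ s * q, s * c, by rw [hqc, map_mul, mul_add, mul_assoc]⟩
  | add x y hx hy =>
    obtain ⟨q, c, rfl⟩ := hx
    obtain ⟨q', c', rfl⟩ := hy
    exact ⟨q + q', c + c', by rw [add_mul, map_add, add_add_add_comm]⟩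

include h in
theorem eq_zero_of_mul_sub_eq_zero {a : S} {p : R} (hp : p * (t - φ a) = 0) : p = 0 := by
  have coeff_eq (i : ℕ) : h.coeff p i = h.coeff p (i + 1) * σ^[i + 1] a := by
    rw [mul_sub, sub_eq_zero] at hp
    rw [← h.coeff_mul_self_succ, hp, h.coeff_mul_map]
  obtain ⟨d, hd⟩ := Filter.eventually_atTop.1 (h.eventually_coeff_eq_zero p)
  have vanish (i j : ℕ) (hij : d ≤ j + i) : h.coeff p j = 0 := by
    induction i generalizing j with
    | zero => exact hd j hij
    | succ i ih => rw [coeff_eq, ih (j + 1) (by lia), zero_mul]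
  refine h.coeff.injective (Finsupp.ext fun j => ?_)
  simpa using vanish d j (by lia)

include h in
theorem mapMatrix (ι : Type*) [Fintype ι] [DecidableEq ι] :
    IsOreExtension (φ.mapMatrix (m := ι)) σ.mapMatrix (diagonal fun _ => t) := by
  refine of_coeff ?_
    { toFun := fun W i => of fun a b => h.coeff (W a b) i
      map_zero' := by ext; simp
      map_add' := by intros; ext; simp } ?_ ?_
  · intro M
    ext a b
    simp [h.mul_map]
  · intro M i
    ext j a b
    obtain rfl | hij := eq_or_ne j i <;> simp [diagonal_pow, h.coeff_map_mul_pow, *]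
  · refine (AddSubmonoid.eq_top_iff' _).2 fun W => ?_
    induction W using Matrix.induction_on' with
    | h_zero => exact zero_mem _
    | h_add V W hV hW => exact add_mem hV hW
    | h_std_basis a b p =>
      induction p using h.induction_add with
      | map_mul_pow s i =>
        refine AddSubmonoid.subset_closure ⟨single a b s, i, ?_⟩
        ext
        simp [diagonal_pow, single_apply, ite_mul]
      | add x y hx hy =>
        rw [single_add]
        exact add_mem hx hy

theorem coeff_mapMatrix_apply {ι : Type*} [Fintype ι] [DecidableEq ι] (W : Matrix ι ι R) (i : ℕ)
    (a b : ι) : (h.mapMatrix ι).coeff W i a b = h.coeff (W a b) i := by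
  induction W using (h.mapMatrix ι).induction_add with
  | map_mul_pow M j =>
    rw [coeff_map_mul_pow]
    obtain rfl | hij := eq_or_ne j i <;> simp [diagonal_pow, h.coeff_map_mul_pow, *]
  | add V W hV hW => simp [hV, hW]

theorem coeff_mapMatrix_fromBlocks {ι : Type*} [Fintype ι] [DecidableEq ι] (V W X Y : Matrix ι ι R)
    (i : ℕ) : (h.mapMatrix (ι ⊕ ι)).coeff (fromBlocks V W X Y) i =
      fromBlocks ((h.mapMatrix ι).coeff V i) ((h.mapMatrix ι).coeff W i)
        ((h.mapMatrix ι).coeff X i) ((h.mapMatrix ι).coeff Y i) := by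
  ext (a | a) (b | b) <;> simp [h.coeff_mapMatrix_apply]

end Ring

end IsOreExtension

/-! ### Invertible matrices over an Ore extension -/

theorem isUnit_fromBlocks_one {ι κ R : Type*} [Fintype ι] [DecidableEq ι] [Fintype κ]
    [DecidableEq κ] [Ring R] {X : Matrix ι ι R} (h : IsUnit X) :
    IsUnit (fromBlocks X 0 0 (1 : Matrix κ κ R)) := by
  obtain ⟨⟨X, Y, hXY, hYX⟩, rfl⟩ := h
  exact ⟨⟨fromBlocks X 0 0 1, fromBlocks Y 0 0 1, by simp [fromBlocks_multiply, hXY],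
    by simp [fromBlocks_multiply, hYX]⟩, rfl⟩

theorem isUnit_of_isUnit_fromBlocks_one {ι κ R : Type*} [Fintype ι] [DecidableEq ι] [Fintype κ]
    [DecidableEq κ] [Ring R] {X : Matrix ι ι R} {D : Matrix ι κ R}
    (h : IsUnit (fromBlocks X D 0 (1 : Matrix κ κ R))) : IsUnit X := by
  obtain ⟨⟨_, W, hW, hW'⟩, rfl⟩ := h
  rw [← fromBlocks_toBlocks W, fromBlocks_multiply, ← fromBlocks_one, fromBlocks_inj] at hW hW'
  have h₂₁ : W.toBlocks₂₁ = 0 := by simpa using hW.2.2.1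
  exact ⟨⟨X, W.toBlocks₁₁, by simpa [h₂₁] using hW.1, by simpa using hW'.1⟩, rfl⟩

theorem exists_elementaryMatrices_mul_inr_eq_zero {ι A : Type*} [Fintype ι] [DecidableEq ι]
    [EuclideanDomain A] {N : Matrix (ι ⊕ Unit) (ι ⊕ Unit) A} (hN : N.det = 0) :
    ∃ g ∈ elementaryMatrices (ι ⊕ Unit) A, ∃ h ∈ elementaryMatrices (ι ⊕ Unit) A,
      h * g = 1 ∧ (g * N) (Sum.inr ()) = 0 := by
  obtain ⟨v, hv, hvN⟩ := exists_vecMul_eq_zero_iff.2 hN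
  obtain ⟨h, hh, hvh⟩ := exists_vecMul_inl_eq_zero v
  obtain ⟨g, hg, hhg, -⟩ := elementaryMatrices.exists_inverse hh
  refine ⟨g, hg, h, hh, hhg, ?_⟩
  have hlast : v ᵥ* h = Pi.single (Sum.inr ()) ((v ᵥ* h) (Sum.inr ())) := by
    ext (i | i) <;> simp [hvh]
  have hne : (v ᵥ* h) (Sum.inr ()) ≠ 0 := fun h0 => hv <| by
    rw [h0, Pi.single_zero] at hlast
    rw [← vecMul_one v, ← hhg, ← vecMul_vecMul, hlast, zero_vecMul]
  have hzero : (v ᵥ* h) ᵥ* (g * N) = 0 := by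
    rw [vecMul_vecMul, ← Matrix.mul_assoc, hhg, Matrix.one_mul, hvN]
  rw [hlast, single_vecMul] at hzero
  exact (smul_eq_zero_iff_right hne).1 hzero

namespace IsOreExtension

section Ring

variable {S R : Type*} [Ring S] [Ring R] {φ : S →+* R} {σ : S →+* S} {t : R}

theorem map_mul_one_add_mul_map (h : IsOreExtension φ σ t) {g g' : S} (hg : g * g' = 1) (s : S) :
    φ g * (1 + φ s * t) * φ g' = 1 + φ (g * s * σ g') * t := by
  rw [mul_add, add_mul, mul_one, ← map_mul, hg, map_one]
  simp only [mul_assoc, map_mul, h.mul_map]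

theorem one_add_map_mul_eq_fromBlocks {ι : Type*} [Fintype ι] [DecidableEq ι]
    {N : Matrix (ι ⊕ Unit) (ι ⊕ Unit) S} (hN : N (Sum.inr ()) = 0) :
    1 + φ.mapMatrix N * diagonal (fun _ => t) =
      fromBlocks (1 + φ.mapMatrix N.toBlocks₁₁ * diagonal fun _ => t)
        (N.toBlocks₁₂.map fun a => φ a * t) 0 1 := by
  ext (a | a) (b | b) <;> simp [one_apply, toBlocks₁₁, toBlocks₁₂, hN]

end Ring

section Domain

variable {A R : Type*} [CommRing A] [IsDomain A] [Ring R] {φ : A →+* R} {σ : A →+* A} {t : R}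

/- The coefficients of a left inverse `V` satisfy `V₀ = 1` and `Vᵢ₊₁ = -Vᵢ σⁱ(N)`, and they vanish
from some point on. -/
theorem det_eq_zero_of_isUnit_one_add (h : IsOreExtension φ σ t) (hσ : Function.Injective σ)
    {ι : Type*} [Fintype ι] [DecidableEq ι] [Nonempty ι] {N : Matrix ι ι A}
    (hN : IsUnit (1 + φ.mapMatrix N * diagonal fun _ => t)) : N.det = 0 := by
  let H := h.mapMatrix ι
  obtain ⟨V, hV⟩ := hN.exists_left_inv
  rw [mul_add, mul_one, ← mul_assoc] at hV
  have coeff_zero : H.coeff V 0 = 1 := by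
    have := congrArg (H.coeff · 0) hV
    simpa [H.coeff_one, H.coeff_mul_self_zero] using this
  have coeff_succ (i : ℕ) : H.coeff V (i + 1) = -(H.coeff V i * σ.mapMatrix^[i] N) := by
    have := congrArg (H.coeff · (i + 1)) hV
    rw [eq_neg_iff_add_eq_zero]
    simpa [H.coeff_one, H.coeff_mul_self_succ, H.coeff_mul_map, -RingHom.mapMatrix_apply] using this
  have det_iterate (i : ℕ) : (σ.mapMatrix^[i] N).det = σ^[i] N.det :=
    Function.Semiconj.iterate_right (f := det) (fun M => (σ.map_det M).symm) i N
  by_contra hdet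
  have det_coeff_ne_zero (i : ℕ) : (H.coeff V i).det ≠ 0 := by
    induction i with
    | zero => simp [coeff_zero]
    | succ i ih =>
      have : σ^[i] N.det ≠ 0 := fun h0 =>
        hdet ((hσ.iterate i) (h0.trans (iterate_map_zero σ i).symm))
      simp [coeff_succ, det_neg, det_iterate, ih, this]
  obtain ⟨i, hi⟩ := (H.eventually_coeff_eq_zero V).exists
  exact det_coeff_ne_zero i (by rw [hi, det_zero])

end Domain

section EuclideanDomain

variable {A R : Type*} [EuclideanDomain A] [Ring R] {φ : A →+* R} {σ : A →+* A} {t : R}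
  (h : IsOreExtension φ σ t) (hσ : Function.Injective σ) {ι : Type} [Fintype ι] [DecidableEq ι]

include h

theorem exists_elementaryMatrices_mul_fromBlocks_mul {N : Matrix (ι ⊕ Unit) (ι ⊕ Unit) A}
    (hN : N.det = 0) :
    ∃ u ∈ elementaryMatrices (ι ⊕ Unit) R, ∃ v ∈ elementaryMatrices (ι ⊕ Unit) R,
      ∃ (N' : Matrix ι ι A) (B : Matrix ι Unit R), 1 + φ.mapMatrix N * diagonal (fun _ => t) =
        u * fromBlocks (1 + φ.mapMatrix N' * diagonal fun _ => t) B 0 1 * v := by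
  obtain ⟨g, hg, g', hg', hg'g, hrow⟩ := exists_elementaryMatrices_mul_inr_eq_zero hN
  have hrow' : (g * N * σ.mapMatrix g') (Sum.inr ()) = 0 := by
    rw [mul_apply_eq_vecMul, hrow, zero_vecMul]
  have hconj : g' * (g * N * σ.mapMatrix g') * σ.mapMatrix g = N := by
    rw [← mul_assoc, ← mul_assoc, hg'g, one_mul, mul_assoc, ← map_mul, hg'g, map_one, mul_one]
  refine ⟨_, elementaryMatrices.map_mem φ hg', _, elementaryMatrices.map_mem φ hg, _, _,
    Eq.trans ?_ (congrArg (φ.mapMatrix g' * · * φ.mapMatrix g)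
      (one_add_map_mul_eq_fromBlocks hrow'))⟩
  rw [(h.mapMatrix _).map_mul_one_add_mul_map hg'g, hconj]

include hσ

theorem one_add_mem_elementaryMatrices {N : Matrix ι ι A}
    (hN : IsUnit (1 + φ.mapMatrix N * diagonal fun _ => t)) :
    1 + φ.mapMatrix N * diagonal (fun _ => t) ∈ elementaryMatrices ι R := by
  revert N
  refine fintype_induction_sum_unit (P := fun ι _ _ => ∀ {N : Matrix ι ι A},
    IsUnit (1 + φ.mapMatrix N * diagonal fun _ => t) →
      1 + φ.mapMatrix N * diagonal (fun _ => t) ∈ elementaryMatrices ι R) ?_ ?_ ?_ ι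
  · intro ι κ _ _ _ _ e ih N hN
    have key : 1 + φ.mapMatrix N * diagonal (fun _ => t) = reindexRingEquiv R e
        (1 + φ.mapMatrix (N.reindex e.symm e.symm) * diagonal fun _ => t) := by
      ext
      simp [one_apply]
    rw [key] at hN ⊢
    exact elementaryMatrices.reindex_mem e (ih ((MulEquiv.isUnit_map _).1 hN))
  · intro N _
    rw [Subsingleton.elim (1 + _) 1]
    exact one_mem _
  · intro ι _ _ ih N hN
    obtain ⟨u, hu, v, hv, N', B, hN'⟩ :=
      h.exists_elementaryMatrices_mul_fromBlocks_mul (h.det_eq_zero_of_isUnit_one_add hσ hN)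
    rw [hN', (elementaryMatrices.isUnit hv).mul_right_iff,
      (elementaryMatrices.isUnit hu).mul_left_iff] at hN
    rw [hN']
    exact mul_mem (mul_mem hu (elementaryMatrices.fromBlocks_mem
      (ih (isUnit_of_isUnit_fromBlocks_one hN)) (one_mem _) B)) hv

theorem mem_elementaryMatrices_of_isUnit_of_coeff_eq_zero {W : Matrix ι ι R} (hW : IsUnit W)
    (hdeg : ∀ i, 1 < i → (h.mapMatrix ι).coeff W i = 0) : W ∈ elementaryMatrices ι R := by
  let H := h.mapMatrix ι
  let C := H.coeff W 0
  have hC : C ∈ elementaryMatrices ι A :=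
    mem_elementaryMatrices_of_isUnit (hW.map H.constantCoeff)
  obtain ⟨C', -, hCC', -⟩ := elementaryMatrices.exists_inverse hC
  obtain ⟨Q, hQ⟩ := H.exists_eq_map_add_mul W
  have hQ_eq : Q = φ.mapMatrix (H.coeff Q 0) := by
    refine H.coeff.injective (Finsupp.ext fun i => ?_)
    cases i with
    | zero => simp only [H.coeff_map, Finsupp.single_eq_same]
    | succ i =>
      have := hdeg (i + 2) (by lia)
      rw [hQ] at this
      simpa [H, coeff_map, coeff_mul_self_succ, -RingHom.mapMatrix_apply] using this
  have hfactor : W = φ.mapMatrix C *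
      (1 + φ.mapMatrix (C' * H.coeff Q 0) * diagonal fun _ => t) := by
    rw [mul_add, mul_one, ← mul_assoc, ← map_mul, ← mul_assoc, hCC', one_mul, ← hQ_eq]
    exact hQ
  have hφC := elementaryMatrices.map_mem φ hC
  rw [hfactor] at hW ⊢
  exact mul_mem hφC
    (h.one_add_mem_elementaryMatrices hσ (((elementaryMatrices.isUnit hφC).mul_left_iff).1 hW))

/- Higman's linearization: the new unknowns `Y = t X` lower the degree in `t` of a system. -/
theorem mem_leftStabilizer_of_coeff_eq_zero (d : ℕ) {U : Matrix ι ι R} (hU : IsUnit U)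
    (hdeg : ∀ i, d + 1 < i → (h.mapMatrix ι).coeff U i = 0) : U ∈ ElemEquiv.leftStabilizer ι R := by
  induction d generalizing ι with
  | zero =>
    exact ElemEquiv.elementaryMatrices_le_leftStabilizer
      (h.mem_elementaryMatrices_of_isUnit_of_coeff_eq_zero hσ hU (by simpa using hdeg))
  | succ d ih =>
    let H := h.mapMatrix ι
    let D : Matrix ι ι R := diagonal fun _ => t
    obtain ⟨Q, hQ⟩ := H.exists_eq_map_add_mul U
    let W := fromBlocks (φ.mapMatrix (H.coeff U 0)) Q (-D) 1
    have hupper := elementaryMatrices.fromBlocks_one_one_mem (-Q)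
    have hlower := elementaryMatrices.fromBlocks_one_zero_mem D
    have hU_eq : fromBlocks U 0 0 (1 : Matrix ι ι R) =
        fromBlocks 1 (-Q) 0 1 * W * fromBlocks 1 0 D 1 := by
      have : φ.mapMatrix (H.coeff U 0) = U - Q * D := eq_sub_of_add_eq hQ.symm
      simp [W, fromBlocks_multiply, this, -RingHom.mapMatrix_apply]
    have hW_unit : IsUnit W := by
      have hU' := isUnit_fromBlocks_one (κ := ι) hU
      rwa [hU_eq, (elementaryMatrices.isUnit hlower).mul_right_iff,
        (elementaryMatrices.isUnit hupper).mul_left_iff] at hU'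
    have hW_deg (i : ℕ) (hi : d + 1 < i) : (h.mapMatrix (ι ⊕ ι)).coeff W i = 0 := by
      have hQ_coeff : H.coeff Q i = 0 := by
        have := hdeg (i + 1) (by lia)
        rw [hQ] at this
        simpa [H.coeff_map, H.coeff_mul_self_succ, -RingHom.mapMatrix_apply] using this
      rw [h.coeff_mapMatrix_fromBlocks, map_neg, H.coeff_map, H.coeff_self, H.coeff_one]
      simp [hQ_coeff, show 0 ≠ i by lia, show 1 ≠ i by lia]
    refine ElemEquiv.mem_leftStabilizer_of_fromBlocks_one_mem (κ := ι) ?_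
    rw [hU_eq]
    exact mul_mem
      (mul_mem (ElemEquiv.elementaryMatrices_le_leftStabilizer hupper) (ih hW_unit hW_deg))
      (ElemEquiv.elementaryMatrices_le_leftStabilizer hlower)

theorem mem_leftStabilizer_of_isUnit {U : Matrix ι ι R} (hU : IsUnit U) :
    U ∈ ElemEquiv.leftStabilizer ι R := by
  obtain ⟨d, hd⟩ := Filter.eventually_atTop.1 ((h.mapMatrix ι).eventually_coeff_eq_zero U)
  exact h.mem_leftStabilizer_of_coeff_eq_zero hσ d hU fun i hi => hd i (by lia)

end EuclideanDomain

end IsOreExtension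

/-! ### Presentations by independent relations -/

section Presents

variable {R M : Type*} [Ring R] [AddCommGroup M] [Module R M]
  {ι κ ι' κ' μ : Type*} [Fintype ι] [Fintype κ] [Fintype ι'] [Fintype κ']

theorem linearCombination_sum_smul (P : Matrix ι κ R) (x : κ → M) (w : ι → R) :
    Fintype.linearCombination R (fun i => ∑ j, P i j • x j) w =
      Fintype.linearCombination R x (w ᵥ* P) := by
  simp only [Fintype.linearCombination_apply, Finset.smul_sum, vecMul, dotProduct, Finset.sum_smul,
    mul_smul]
  exact Finset.sum_comm

/-- The family `x` generates the module `M`, and the rows of `P` are a basis of the module of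
relations between the `x i`. -/
structure Presents (P : Matrix ι κ R) (x : κ → M) : Prop where
  injective : Function.Injective P.vecMulLinear
  exact : Function.Exact P.vecMulLinear (Fintype.linearCombination R x)
  surjective : Function.Surjective (Fintype.linearCombination R x)

namespace Presents

variable {P P' : Matrix ι κ R} {x : κ → M}

theorem reindex (h : Presents P x) (e : ι ≃ ι') (f : κ ≃ κ') :
    Presents (P.reindex e f) (x ∘ f.symm) := by
  have vecMul_reindex (v : ι' → R) :
      (P.reindex e f).vecMulLinear v = P.vecMulLinear (v ∘ e) ∘ f.symm :=
    submatrix_vecMul_equiv _ _ _ _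
  have linearCombination_comp (v : κ' → R) :
      Fintype.linearCombination R (x ∘ f.symm) v = Fintype.linearCombination R x (v ∘ f) := by
    simpa [Fintype.linearCombination_apply] using (f.sum_comp fun j => v j • x (f.symm j)).symm
  refine ⟨fun v w hvw => ?_, fun v => ?_, fun m => ?_⟩
  · rw [vecMul_reindex, vecMul_reindex] at hvw
    exact e.surjective.injective_comp_right
      (h.injective (f.symm.surjective.injective_comp_right hvw))
  · rw [linearCombination_comp, h.exact]
    constructor
    · rintro ⟨w, hw⟩
      exact ⟨w ∘ e.symm, by rw [vecMul_reindex]; simp [Function.comp_assoc, hw]⟩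
    · rintro ⟨w, rfl⟩
      exact ⟨w ∘ e, by rw [vecMul_reindex]; simp [Function.comp_assoc]⟩
  · obtain ⟨v, rfl⟩ := h.surjective m
    exact ⟨v ∘ f.symm, by simp [linearCombination_comp, Function.comp_assoc]⟩

theorem adjoin [Fintype μ] [DecidableEq μ] (h : Presents P x) (S : Matrix μ κ R) :
    Presents (fromBlocks P 0 (-S) (1 : Matrix μ μ R))
      (Sum.elim x fun j => ∑ i, S j i • x i) := by
  have linearCombination_elim (v : κ ⊕ μ → R) :
      Fintype.linearCombination R (Sum.elim x fun j => ∑ i, S j i • x i) v =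
        Fintype.linearCombination R x (v ∘ Sum.inl + (v ∘ Sum.inr) ᵥ* S) := by
    rw [map_add, ← linearCombination_sum_smul]
    simp [Fintype.linearCombination_apply]
  have vecMulLinear_fromBlocks (v : ι ⊕ μ → R) :
      (fromBlocks P 0 (-S) (1 : Matrix μ μ R)).vecMulLinear v =
        Sum.elim (P.vecMulLinear (v ∘ Sum.inl) - (v ∘ Sum.inr) ᵥ* S) (v ∘ Sum.inr) := by
    simp [vecMul_fromBlocks, vecMul_neg, sub_eq_add_neg]
  refine ⟨?_, fun v => ?_, fun m => ?_⟩
  · rw [injective_iff_map_eq_zero]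
    intro v hv
    rw [vecMulLinear_fromBlocks] at hv
    have hr : v ∘ Sum.inr = 0 := congrArg (· ∘ Sum.inr) hv
    have hl : P.vecMulLinear (v ∘ Sum.inl) = 0 := by simpa [hr] using congrArg (· ∘ Sum.inl) hv
    rw [map_eq_zero_iff _ h.injective] at hl
    rw [← Sum.elim_comp_inl_inr v, hl, hr, Sum.elim_zero_zero]
  · rw [linearCombination_elim, h.exact]
    constructor
    · rintro ⟨w, hw⟩
      refine ⟨Sum.elim w (v ∘ Sum.inr), ?_⟩
      rw [vecMulLinear_fromBlocks]
      simp [hw]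
    · rintro ⟨w, rfl⟩
      refine ⟨w ∘ Sum.inl, ?_⟩
      rw [vecMulLinear_fromBlocks]
      simp
  · obtain ⟨v, rfl⟩ := h.surjective m
    exact ⟨Sum.elim v 0, by simp [linearCombination_elim]⟩

theorem mul_right_cancel (h : Presents P x) {U V : Matrix μ ι R} (hUV : U * P = V * P) : U = V := by
  refine funext fun i => ?_
  refine h.injective ?_
  rw [vecMulLinear_apply, vecMulLinear_apply, ← mul_apply_eq_vecMul, hUV, mul_apply_eq_vecMul]

theorem exists_eq_mul (h : Presents P x) (h' : Presents P' x) : ∃ U : Matrix ι ι R, P' = U * P := by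
  classical
  have row_mem (i : ι) : P' i ∈ Set.range P.vecMulLinear :=
    (h.exact _).1 ((h'.exact _).2 ⟨Pi.single i 1, single_one_vecMul _ _⟩)
  choose U hU using row_mem
  exact ⟨of U, funext fun i => by rw [mul_apply_eq_vecMul]; exact (hU i).symm⟩

theorem exists_isUnit_eq_mul [DecidableEq ι] (h : Presents P x) (h' : Presents P' x) :
    ∃ U : Matrix ι ι R, IsUnit U ∧ P' = U * P := by
  obtain ⟨U, hU⟩ := h.exists_eq_mul h'
  obtain ⟨V, hV⟩ := h'.exists_eq_mul h
  refine ⟨U, ⟨⟨U, V, h'.mul_right_cancel ?_, h.mul_right_cancel ?_⟩, rfl⟩, hU⟩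
  · rw [Matrix.mul_assoc, ← hV, ← hU, Matrix.one_mul]
  · rw [Matrix.mul_assoc, ← hU, ← hV, Matrix.one_mul]

theorem elemEquiv {ι κ : Type} [Fintype ι] [Fintype κ]
    (leftStabilizer_of_isUnit : ∀ {ι : Type} [Fintype ι] [DecidableEq ι] {U : Matrix ι ι R},
      IsUnit U → U ∈ ElemEquiv.leftStabilizer ι R)
    {P : Matrix ι ι R} {Q : Matrix κ κ R} {x : ι → M} {y : κ → M}
    (hP : Presents P x) (hQ : Presents Q y) : ElemEquiv P Q := by
  classical
  choose S hS using fun j => hP.surjective (y j)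
  choose T hT using fun i => hQ.surjective (x i)
  have hPS := hP.adjoin (of S)
  have hQT := (hQ.adjoin (of T)).reindex (Equiv.sumComm κ ι) (Equiv.sumComm κ ι)
  have hgens : (Sum.elim y fun i => ∑ j, of T i j • y j) ∘ (Equiv.sumComm κ ι).symm =
      Sum.elim x fun j => ∑ i, of S j i • x i := by
    ext (i | j)
    · simpa [Fintype.linearCombination_apply] using hT i
    · simpa [Fintype.linearCombination_apply] using (hS j).symm
  rw [hgens] at hQT
  obtain ⟨U, hU, hQ_eq⟩ := hPS.exists_isUnit_eq_mul hQT
  refine (ElemEquiv.adjoin_matrix P (of S)).trans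
    (.trans ?_ (ElemEquiv.adjoin_matrix Q (of T)).symm)
  refine (leftStabilizer_of_isUnit hU _ _).trans ?_
  rw [← hQ_eq]
  exact (ElemEquiv.reindex _ _ _).symm

end Presents

end Presents

section BasisOver

variable {S R M : Type*} [Ring S] [Ring R] [AddCommGroup M] [Module R M] {φ : S →+* R}
  {σ : S →+* S} {t : R} {ι : Type*} [Fintype ι] [DecidableEq ι]

theorem sum_diagonal_sub_map_smul (φ : S →+* R) (t : R) (A : Matrix ι ι S) (x : ι → M) (i : ι) :
    ∑ j, (diagonal (fun _ => t) - A.map φ : Matrix ι ι R) i j • x j =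
      t • x i - ∑ j, φ (A i j) • x j := by
  simp [sub_smul, diagonal_apply, ite_smul]

namespace IsOreExtension

variable (h : IsOreExtension φ σ t)

include h

theorem vecMulLinear_diagonal_sub_map_injective (A : Matrix ι ι S) :
    Function.Injective (diagonal (fun _ => t) - A.map φ).vecMulLinear := by
  rw [injective_iff_map_eq_zero]
  intro v hv
  have hV : (of fun _ : ι => v) = 0 :=
    (h.mapMatrix ι).eq_zero_of_mul_sub_eq_zero (a := A) (funext fun _ => hv)
  exact funext fun i => congrFun (congrFun hV i) i

theorem exists_eq_vecMul_diagonal_sub_map_add (A : Matrix ι ι S) (v : ι → R) :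
    ∃ (w : ι → R) (c : ι → S), v = w ᵥ* (diagonal (fun _ => t) - A.map φ) + φ ∘ c := by
  obtain _ | ⟨⟨i⟩⟩ := isEmpty_or_nonempty ι
  · exact ⟨0, 0, Subsingleton.elim _ _⟩
  · obtain ⟨Q, C, hQC⟩ := (h.mapMatrix ι).exists_eq_mul_sub_add A (of fun _ => v)
    exact ⟨Q i, C i, congrFun hQC i⟩

theorem presents_diagonal_sub_map {b : ι → M} (hb : IsBasisOver φ b) {A : Matrix ι ι S}
    (hA : ∀ i, t • b i = ∑ j, φ (A i j) • b j) :
    Presents (diagonal (fun _ => t) - A.map φ) b where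
  injective := h.vecMulLinear_diagonal_sub_map_injective A
  exact v := by
    have linearCombination_vecMul (w : ι → R) :
        Fintype.linearCombination R b (w ᵥ* (diagonal (fun _ => t) - A.map φ)) = 0 := by
      have hrel : (fun i => ∑ j, (diagonal (fun _ => t) - A.map φ : Matrix ι ι R) i j • b j) = 0 :=
        funext fun i => by rw [sum_diagonal_sub_map_smul, hA, sub_self, Pi.zero_apply]
      rw [← linearCombination_sum_smul, hrel]
      simp [Fintype.linearCombination_apply]
    constructor
    · intro hv
      obtain ⟨w, c, rfl⟩ := h.exists_eq_vecMul_diagonal_sub_map_add A v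
      rw [map_add, linearCombination_vecMul, zero_add] at hv
      have hc : c = 0 := hb.injective (hv.trans (by simp))
      have hφc : φ ∘ c = 0 := by rw [hc]; exact funext fun _ => map_zero φ
      exact ⟨w, by rw [hφc, add_zero, vecMulLinear_apply]⟩
    · rintro ⟨w, rfl⟩
      exact linearCombination_vecMul w
  surjective m := by
    obtain ⟨a, rfl⟩ := hb.surjective m
    exact ⟨φ ∘ a, rfl⟩

end IsOreExtension

end BasisOver

/-! ### The Anderson ring as an Ore extension -/

namespace AndersonRing

open Multiplicative

variable {k : Type*} [Field k]

/-- The coefficient of `T ^ u`, an element of `k{τ}`. -/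
def coeffT (u : ℕ) : AndersonRing k →+ TauRing k :=
  SkewMonoidAlgebra.coeffAddEquiv.symm.toAddMonoidHom.comp
    ((Finsupp.mapRange.addMonoidHom (Polynomial.lcoeff k u).toAddMonoidHom).comp
      SkewMonoidAlgebra.coeffAddEquiv.toAddMonoidHom)

theorem coeffT_monomial (u n : ℕ) (a : Polynomial k) :
    coeffT u (SkewPolynomial.monomial n a : AndersonRing k) =
      SkewPolynomial.monomial n (a.coeff u) :=
  congrArg SkewMonoidAlgebra.ofCoeff
    (Finsupp.mapRange_single (hf := Polynomial.coeff_zero u) (a := ofAdd n) (b := a))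

theorem addSubmonoid_eq_top_of_monomial_mem {N : AddSubmonoid (AndersonRing k)}
    (hN : ∀ n a, SkewPolynomial.monomial n a ∈ N) : N = ⊤ := by
  refine eq_top_iff.2 fun p _ => ?_
  induction p using SkewPolynomial.induction with
  | h0 => exact zero_mem _
  | ha n a q _ _ ih => exact add_mem (hN n a) (ih trivial)

variable [MulSemiringAction (Multiplicative ℕ) k]

theorem ofPoly_mul_tau_pow (a : Polynomial k) (n : ℕ) :
    ofPoly k a * tau k ^ n = SkewPolynomial.monomial n a :=
  SkewPolynomial.C_mul_X_pow_eq_monomial (n := n)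

theorem ofTau_monomial_mul_T_pow (n u : ℕ) (c : k) :
    ofTau k (SkewPolynomial.monomial n c) * T k ^ u =
      SkewPolynomial.monomial n (Polynomial.monomial u c) := by
  rw [ofTau_monomial, T, ← map_pow]
  change _ * SkewPolynomial.C _ = _
  rw [SkewPolynomial.monomial_mul_C, SkewPolynomial.φ_iterate_apply, smul_pow', Polynomial.smul_X,
    Polynomial.C_mul_X_pow_eq_monomial]

variable (k)

/-- The endomorphism `∑ aⱼ Tʲ ↦ ∑ aⱼ⁽¹⁾ Tʲ` of `k[T]`, by which `τ` commutes with polynomials. -/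
def polyTwist : Polynomial k →+* Polynomial k :=
  MulSemiringAction.toRingHom (Multiplicative ℕ) (Polynomial k) (ofAdd 1)

theorem polyTwist_injective : Function.Injective (polyTwist k) := by
  intro a b hab
  simp only [polyTwist, MulSemiringAction.toRingHom_apply, Polynomial.smul_eq_map] at hab
  exact Polynomial.map_injective _ (RingHom.injective _) hab

theorem isOreExtension_ofPoly : IsOreExtension (ofPoly k) (polyTwist k) (tau k) :=
  .of_coeff
    (mul_map := fun a => by
      change SkewPolynomial.monomial 1 1 * SkewPolynomial.C a =
        SkewPolynomial.C (ofAdd 1 • a) * SkewPolynomial.monomial 1 1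
      rw [SkewPolynomial.monomial_mul_C, SkewPolynomial.C_mul_monomial, one_mul, mul_one]
      rfl)
    (coeff := AddMonoidHom.mk' SkewPolynomial.coeff fun p q =>
      funext (SkewPolynomial.coeff_add p q))
    (coeff_map_mul_pow := fun a i => funext fun j => by
      rw [ofPoly_mul_tau_pow, AddMonoidHom.mk'_apply, SkewPolynomial.coeff_monomial,
        Pi.single_apply]
      simp only [eq_comm])
    (closure := addSubmonoid_eq_top_of_monomial_mem fun n a =>
      AddSubmonoid.subset_closure ⟨a, n, (ofPoly_mul_tau_pow a n).symm⟩)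

theorem isOreExtension_ofTau : IsOreExtension (ofTau k) (RingHom.id _) (T k) :=
  .of_coeff
    (mul_map := T_mul_ofTau k)
    (coeff := AddMonoidHom.mk' (fun p u => coeffT u p) fun p q => funext fun u => map_add _ p q)
    (coeff_map_mul_pow := fun s u => funext fun v => by
      change coeffT v (ofTau k s * T k ^ u) = _
      induction s using SkewPolynomial.induction with
      | h0 => simp
      | ha n c q _ _ ih =>
        rw [map_add, add_mul, map_add, ih, ofTau_monomial_mul_T_pow, coeffT_monomial,
          Polynomial.coeff_monomial, Pi.single_add, Pi.add_apply]
        obtain rfl | huv := eq_or_ne u v <;> simp [*])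
    (closure := addSubmonoid_eq_top_of_monomial_mem fun n a => by
      induction a using Polynomial.induction_on' with
      | add a b ha hb => rw [map_add]; exact add_mem ha hb
      | monomial u c =>
        exact AddSubmonoid.subset_closure ⟨_, u, (ofTau_monomial_mul_T_pow n u c).symm⟩)

end AndersonRing

/-! ### Linear maps as solutions -/

section LinearMaps

theorem Presents.bijOn_linearMap {R M N ι κ : Type*} [Ring R] [AddCommGroup M] [Module R M]
    [AddCommGroup N] [Module R N] [Fintype ι] [Fintype κ] {P : Matrix ι κ R} {x : κ → M}
    (h : Presents P x) :
    Set.BijOn (fun (ψ : M →ₗ[R] N) j => ψ (x j)) Set.univ {X | ∀ i, ∑ j, P i j • X j = 0} := by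
  classical
  have map_linearCombination (ψ : M →ₗ[R] N) (v : κ → R) :
      ψ (Fintype.linearCombination R x v) = Fintype.linearCombination R (ψ ∘ x) v := by
    simp [Fintype.linearCombination_apply]
  refine ⟨fun ψ _ i => ?_, fun ψ _ ψ' _ hψ => LinearMap.ext fun m => ?_, fun X hX => ?_⟩
  · have hrow : ∑ j, P i j • x j = 0 :=
      (h.exact _).2 ⟨Pi.single i 1, single_one_vecMul i P⟩
    simpa using congrArg ψ hrow
  · obtain ⟨v, rfl⟩ := h.surjective m
    rw [map_linearCombination, map_linearCombination]
    exact congrArg (Fintype.linearCombination R · v) hψ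
  · have hrange : LinearMap.range P.vecMulLinear ≤
        LinearMap.ker (Fintype.linearCombination R X) := by
      rintro _ ⟨w, rfl⟩
      have hrel : (fun i => ∑ j, P i j • X j) = 0 := funext hX
      rw [LinearMap.mem_ker, vecMulLinear_apply, ← linearCombination_sum_smul, hrel]
      simp [Fintype.linearCombination_apply]
    refine ⟨(LinearMap.range P.vecMulLinear).liftQ _ hrange ∘ₗ
      (h.exact.linearEquivOfSurjective h.surjective).symm, trivial, funext fun j => ?_⟩
    have hx : x j = Fintype.linearCombination R x (Pi.single j 1) := by simp
    dsimp only
    rw [LinearMap.comp_apply, hx, LinearEquiv.coe_coe,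
      h.exact.linearEquivOfSurjective_symm_apply h.surjective]
    simp

theorem IsOreExtension.map_smul_of_map_smul {S R M N : Type*} [Ring S] [Ring R] [AddCommGroup M]
    [Module R M] [AddCommGroup N] [Module R N] {φ : S →+* R} {σ : S →+* S} {t : R}
    (h : IsOreExtension φ σ t) (ψ : M →+ N) (hφ : ∀ s m, ψ (φ s • m) = φ s • ψ m)
    (ht : ∀ m, ψ (t • m) = t • ψ m) (p : R) (m : M) : ψ (p • m) = p • ψ m := by
  induction p using h.induction_add with
  | map_mul_pow s i =>
    rw [mul_smul, mul_smul, hφ]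
    congr 1
    induction i with
    | zero => simp
    | succ i ih => rw [pow_succ', mul_smul, mul_smul, ht, ih]
  | add p q hp hq => rw [add_smul, add_smul, map_add, hp, hq]

variable {k : Type*} [Field k] [MulSemiringAction (Multiplicative ℕ) k]
  {M : Type*} [AddCommGroup M] [Module (AndersonRing k) M]

open AndersonRing

theorem range_toAddMonoidHom_eq_homTau :
    Set.range (LinearMap.toAddMonoidHom : (M →ₗ[AndersonRing k] PowerSeries k) → _) =
      homTau k M := by
  ext φ
  constructor
  · rintro ⟨ψ, rfl⟩
    exact ⟨fun p => map_smul ψ _, map_smul ψ _⟩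
  · rintro ⟨hpoly, htau⟩
    exact ⟨{ φ with map_smul' := (isOreExtension_ofPoly k).map_smul_of_map_smul φ hpoly htau }, rfl⟩

theorem AndersonRing.coeff_ofTau_smul (p : TauRing k) (x : PowerSeries k) (i : ℕ) :
    PowerSeries.coeff i (ofTau k p • x) = p • PowerSeries.coeff i x := by
  have coeff_tau_pow_smul (m : ℕ) :
      PowerSeries.coeff i (tau k ^ m • x) = Multiplicative.ofAdd m • PowerSeries.coeff i x := by
    induction m with
    | zero => simp
    | succ m ih => rw [pow_succ', mul_smul, coeff_tau_smul, ih, ← mul_smul, ← ofAdd_add, add_comm]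
  induction p using SkewPolynomial.induction with
  | h0 => simp
  | ha m c q _ _ ih =>
    rw [map_add, add_smul, add_smul, map_add, ih, ofTau_monomial, ← ofPoly_mul_tau_pow, mul_smul,
      AndersonRing.ofPoly_smul, Polynomial.coe_C, PowerSeries.coeff_C_mul, coeff_tau_pow_smul,
      TauRing.monomial_smul]

theorem AndersonRing.T_smul (x : PowerSeries k) : T k • x = PowerSeries.X * x := by
  rw [T, AndersonRing.ofPoly_smul, Polynomial.coe_X]

/-- The sequence `0, x_1, x_2, …` in `E(M)` with `ψ = ∑ x_{i+1} Tⁱ`. -/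
def coeffSequence (ψ : M →ₗ[AndersonRing k] PowerSeries k) : ℕ → tModulePoints k M
  | 0 => 0
  | i + 1 => ⟨(PowerSeries.coeff i).toAddMonoidHom.comp ψ.toAddMonoidHom, fun p m => by
      simp [coeff_ofTau_smul]⟩

/-- The generating series `∑ x_{i+1} Tⁱ` of a sequence in `E(M)`; the term `x_0` is left out. -/
def generatingSeries (x : ℕ → tModulePoints k M) : M →+ PowerSeries k :=
  AddMonoidHom.mk' (fun m => PowerSeries.mk fun i => (x (i + 1)).1 m) fun a b => by ext; simp

theorem coeff_generatingSeries (x : ℕ → tModulePoints k M) (i : ℕ) (m : M) :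
    PowerSeries.coeff i (generatingSeries x m) = (x (i + 1)).1 m :=
  PowerSeries.coeff_mk i fun i => (x (i + 1)).1 m

theorem generatingSeries_ofTau_smul (x : ℕ → tModulePoints k M) (p : TauRing k) (m : M) :
    generatingSeries x (ofTau k p • m) = ofTau k p • generatingSeries x m := by
  ext i
  rw [coeff_ofTau_smul, coeff_generatingSeries, coeff_generatingSeries]
  exact (x (i + 1)).2 p m

theorem generatingSeries_T_smul {x : ℕ → tModulePoints k M} (hx : x ∈ tateModule k M) (m : M) :
    generatingSeries x (T k • m) = T k • generatingSeries x m := by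
  ext i
  have hxm : (x (i + 1)).1 (T k • m) = (x i).1 m := congrArg (·.1 m) (hx.2 i)
  rw [T_smul, coeff_generatingSeries, hxm]
  cases i with
  | zero => rw [PowerSeries.coeff_zero_X_mul, hx.1]; rfl
  | succ i => rw [PowerSeries.coeff_succ_X_mul, coeff_generatingSeries]

theorem range_coeffSequence_eq_tateModule :
    Set.range (coeffSequence (k := k) (M := M)) = tateModule k M := by
  ext x
  constructor
  · rintro ⟨ψ, rfl⟩
    refine ⟨rfl, fun i => Subtype.ext (AddMonoidHom.ext fun m => ?_)⟩
    change PowerSeries.coeff i (ψ (T k • m)) = _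
    rw [map_smul, T_smul]
    cases i with
    | zero => exact PowerSeries.coeff_zero_X_mul _
    | succ i => exact PowerSeries.coeff_succ_X_mul i _
  · intro hx
    refine ⟨{ generatingSeries x with
      map_smul' := (isOreExtension_ofTau k).map_smul_of_map_smul _ (generatingSeries_ofTau_smul x)
        (generatingSeries_T_smul hx) }, funext fun i => ?_⟩
    cases i with
    | zero => exact hx.1.symm
    | succ i => exact Subtype.ext (AddMonoidHom.ext fun m => coeff_generatingSeries x i m)

end LinearMaps

/-! ### Solutions of the two systems -/

section Solutions

section SmallSeries

variable {k : Type*} [Field k] [TopologicalSpace k] [IsTopologicalRing k]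

theorem IsSmallSeries.add {x y : PowerSeries k} (hx : IsSmallSeries x) (hy : IsSmallSeries y) :
    IsSmallSeries (x + y) := by
  simpa [IsSmallSeries] using Filter.Tendsto.add hx hy

theorem IsSmallSeries.sum {ι : Type*} (s : Finset ι) {x : ι → PowerSeries k}
    (hx : ∀ i ∈ s, IsSmallSeries (x i)) : IsSmallSeries (∑ i ∈ s, x i) := by
  simpa [IsSmallSeries] using tendsto_finsetSum s hx

theorem IsSmallSeries.ofPoly_smul [MulSemiringAction (Multiplicative ℕ) k] (p : Polynomial k)
    {x : PowerSeries k} (hx : IsSmallSeries x) : IsSmallSeries (AndersonRing.ofPoly k p • x) := by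
  induction p using Polynomial.induction_on generalizing x with
  | C c =>
    simpa [IsSmallSeries, AndersonRing.ofPoly_smul] using Filter.Tendsto.const_mul c hx
  | add p q hp hq =>
    rw [map_add, add_smul]
    exact (hp hx).add (hq hx)
  | monomial m c ih =>
    rw [pow_succ, ← mul_assoc, map_mul, mul_smul]
    refine ih ((Filter.tendsto_add_atTop_iff_nat 1).1 (Filter.Tendsto.congr (fun i => ?_) hx))
    rw [AndersonRing.ofPoly_smul, Polynomial.coe_X, PowerSeries.coeff_succ_X_mul]

end SmallSeries

theorem bijOn_range_of_comp {α β γ : Type*} {f : α → β} {g : β → γ} {s : Set γ}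
    (h : Set.BijOn (g ∘ f) Set.univ s) : Set.BijOn g (Set.range f) s := by
  rw [← Set.image_univ]
  exact ⟨Set.mapsTo_image_iff.2 h.mapsTo, h.injOn.image_of_comp,
    by rw [Set.SurjOn, ← Set.image_comp]; exact h.surjOn⟩

variable {k : Type*} [Field k] [MulSemiringAction (Multiplicative ℕ) k]
  {M : Type*} [AddCommGroup M] [Module (AndersonRing k) M]
  {ι κ : Type*} [Fintype ι] [Fintype κ] {P : Matrix ι κ (AndersonRing k)} {f : κ → M}

theorem Presents.bijOn_homTau (h : Presents P f) :
    Set.BijOn (fun (φ : M →+ PowerSeries k) (i : κ) => φ (f i)) (homTau k M)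
      (affineSolutions P) := by
  rw [← range_toAddMonoidHom_eq_homTau]
  exact bijOn_range_of_comp h.bijOn_linearMap

theorem Presents.bijOn_tateModule (h : Presents P f) :
    Set.BijOn (fun (x : ℕ → tModulePoints k M) (j : κ) =>
        PowerSeries.mk fun i => (x (i + 1)).1 (f j))
      (tateModule k M) (affineSolutions P) := by
  rw [← range_coeffSequence_eq_tateModule]
  refine bijOn_range_of_comp (h.bijOn_linearMap.congr fun ψ _ => funext fun j => ?_)
  ext i
  exact (PowerSeries.coeff_mk i fun u => PowerSeries.coeff u (ψ (f j))).symm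

theorem IsBasisOver.isSmallSeries_iff [TopologicalSpace k] [IsTopologicalRing k]
    (hf : IsBasisOver (AndersonRing.ofPoly k) f) {φ : M →+ PowerSeries k} (hφ : φ ∈ homTau k M) :
    (∀ m, IsSmallSeries (φ m)) ↔ ∀ i, IsSmallSeries (φ (f i)) := by
  refine ⟨fun h i => h _, fun h m => ?_⟩
  obtain ⟨a, rfl⟩ := hf.surjective m
  rw [map_sum]
  refine IsSmallSeries.sum _ fun i _ => ?_
  rw [hφ.1]
  exact (h i).ofPoly_smul _

theorem Presents.bijOn_homologyOne [TopologicalSpace k] [IsTopologicalRing k] (h : Presents P f)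
    (hf : IsBasisOver (AndersonRing.ofPoly k) f) :
    Set.BijOn (fun (φ : M →+ PowerSeries k) (i : κ) => φ (f i)) (homologyOne k M)
      {X | X ∈ affineSolutions P ∧ ∀ i, IsSmallSeries (X i)} := by
  refine ⟨fun φ hφ => ⟨h.bijOn_homTau.mapsTo hφ.1, (hf.isSmallSeries_iff hφ.1).1 hφ.2⟩,
    h.bijOn_homTau.injOn.mono fun φ hφ => hφ.1, fun X hX => ?_⟩
  obtain ⟨φ, hφ, rfl⟩ := h.bijOn_homTau.surjOn hX.1
  exact ⟨φ, ⟨hφ, (hf.isSmallSeries_iff hφ).2 hX.2⟩, rfl⟩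

end Solutions

end

theorem proposition2p3p4_general {k : Type*} [Field k] [TopologicalSpace k] [IsTopologicalRing k]
    [MulSemiringAction (Multiplicative ℕ) k]
    {M : Type*} [AddCommGroup M] [Module (AndersonRing k) M] {r n : ℕ}
    (f : Fin r → M) (hf : IsBasisOver (AndersonRing.ofPoly k) f)
    (Q : Matrix (Fin r) (Fin r) (Polynomial k))
    (hQ : ∀ i, AndersonRing.tau k • f i = ∑ j, AndersonRing.ofPoly k (Q i j) • f j)
    (e : Fin n → M) (he : IsBasisOver (AndersonRing.ofTau k) e)
    (A : Matrix (Fin n) (Fin n) (TauRing k))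
    (hA : ∀ i, AndersonRing.T k • e i = ∑ j, AndersonRing.ofTau k (A i j) • e j) :
    Set.BijOn (fun (φ : M →+ PowerSeries k) (i : Fin r) => φ (f i))
      (homTau k M) (affineSolutions (tauSystem Q)) ∧
    Set.BijOn (fun (φ : M →+ PowerSeries k) (i : Fin r) => φ (f i))
      (homologyOne k M) {X | X ∈ affineSolutions (tauSystem Q) ∧ ∀ i, IsSmallSeries (X i)} ∧
    Set.BijOn (fun (x : ℕ → tModulePoints k M) (j : Fin n) =>
        PowerSeries.mk fun i => (x (i + 1)).1 (e j))
      (tateModule k M) (affineSolutions (tateSystem A)) ∧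
    ElemEquiv (tauSystem Q) (tateSystem A) := by
  have hτ : Presents (tauSystem Q) f :=
    (AndersonRing.isOreExtension_ofPoly k).presents_diagonal_sub_map hf hQ
  have hT : Presents (tateSystem A) e :=
    (AndersonRing.isOreExtension_ofTau k).presents_diagonal_sub_map he hA
  exact ⟨hτ.bijOn_homTau, hτ.bijOn_homologyOne hf, hT.bijOn_tateModule,
    hτ.elemEquiv ((AndersonRing.isOreExtension_ofPoly k).mem_leftStabilizer_of_isUnit
      (AndersonRing.polyTwist_injective k)) hT⟩

theorem proposition2p3p4 {F : Type*} [Field F] [Fintype F]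
    {M : Type*} [AddCommGroup M] [Module (AndersonRing (CInf F)) M]
    (hM : IsAndersonTMotive (CInf.theta F) M)
    {r n : ℕ}
    (f : Fin r → M) (hf : IsBasisOver (AndersonRing.ofPoly (CInf F)) f)
    (Q : Matrix (Fin r) (Fin r) (Polynomial (CInf F)))
    (hQ : ∀ i, AndersonRing.tau (CInf F) • f i = ∑ j, AndersonRing.ofPoly (CInf F) (Q i j) • f j)
    (e : Fin n → M) (he : IsBasisOver (AndersonRing.ofTau (CInf F)) e)
    (A : Matrix (Fin n) (Fin n) (TauRing (CInf F)))
    (hA : ∀ i, AndersonRing.T (CInf F) • e i = ∑ j, AndersonRing.ofTau (CInf F) (A i j) • e j) :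
    -- `(τ I_r - Q) X = 0` defines `Hom(M, ℂ_∞⟦T⟧)^τ`, and its small solutions are `H_1(M)`
    Set.BijOn (fun (φ : M →+ PowerSeries (CInf F)) (i : Fin r) => φ (f i))
      (homTau (CInf F) M) (affineSolutions (tauSystem Q)) ∧
    Set.BijOn (fun (φ : M →+ PowerSeries (CInf F)) (i : Fin r) => φ (f i))
      (homologyOne (CInf F) M)
      {X | X ∈ affineSolutions (tauSystem Q) ∧ ∀ i, IsSmallSeries (X i)} ∧
    -- `(T I_n - A) X = 0` defines the Tate module
    Set.BijOn (fun (x : ℕ → tModulePoints (CInf F) M) (j : Fin n) =>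
        PowerSeries.mk fun i => (x (i + 1)).1 (e j))
      (tateModule (CInf F) M) (affineSolutions (tateSystem A)) ∧
    -- the two systems coincide up to elementary transformations
    ElemEquiv (tauSystem Q) (tateSystem A) := by
  exact proposition2p3p4_general f hf Q hQ e he A hA
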